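/- Let $d\ge 1$ and let $\lambda_{\min}>0$ be the smallest eigenvalue of the Dirichlet Laplace operator $-\Delta$ on the ball $B_{1/2}(0)\subset\mathbb{R}^d$ (eigenfunctions in $H_0^1(B_{1/2}(0))$, eigenvalue equation in the weak sense). There is an associated eigenfunction $H\in H_0^1(B_{1/2}(0))$, extended by zero to $\mathbb{R}^d$, that is positive on $B_{1/2}(0)$ (almost everywhere), satisfies $\int_{\mathbb{R}^d} H^2=1$, and has real-valued Fourier transform $h(\omega)=(2\pi)^{-d/2}\int_{\mathbb{R}^d}H(x)e^{-i\omega^\top x}\,\mathrm{d}x$, such that with $$c_0:=\sqrt2\,\lambda_{\min}^{1/2},\qquad c_1:=\frac{\pi^{d/2}}{2\,\lambda_{\min}^{d/2}},\qquad \beta:=(2\pi)^{d/2}\Big[\min_{\|\omega\|\le\pi}h(\omega)\Big]^2,\qquad c_2:=\Big(\frac2\pi\Big)^{d/2}\frac1\beta ,$$ the constants $c_1,c_2$ (which depend only on $d$) are positive and the following holds. Let $X=\{x_1,\dots,x_n\}\subset\mathbb{R}^d$ be any finite set of pairwise distinct points with separation distance $q_X:=\min_{x_i\ne x_j}\|x_i-x_j\|$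 (if $|X|\le 1$, read $c/q_X$ as $0$), let $x_0\in\mathbb{R}^d$ and $\alpha\in\mathbb{R}^{n}$. Then for every $R\ge c_0/q_X$, $$c_1R^d\|\alpha\|^2\;\le\;\int_{B_R(x_0)}\Big|\sum_{j=1}^{n}\alpha_je^{i\omega^\top x_j}\Big|^2\,\mathrm{d}\omega\;\le\;c_2R^d\|\alpha\|^2 ,$$ and the second inequality already holds for every $R\ge \pi/q_X$. -/

import Mathlib

open MeasureTheory Filter Topology

noncomputable section

/-- `φ ∈ C_c^∞(Ω)`, regarded as a function on the whole space. -/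
structure IsTestFunctionOn {d : ℕ} (Ω : Set (EuclideanSpace ℝ (Fin d)))
    (φ : EuclideanSpace ℝ (Fin d) → ℝ) : Prop where
  contDiff : ContDiff ℝ ((⊤ : ℕ∞) : WithTop ℕ∞) φ
  hasCompactSupport : HasCompactSupport φ
  tsupport_subset : tsupport φ ⊆ Ω

/-- `u ∈ H_0^1(Ω)` with weak gradient `g`, both extended by zero to the whole space:
`(u, g)` is an `L²`-limit of pairs `(φ, ∇φ)` with `φ ∈ C_c^∞(Ω)`, that is, `u` lies in the
closure of `C_c^∞(Ω)` in the `H^1` norm. Functions are considered up to null sets. -/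
structure MemH10 {d : ℕ} (Ω : Set (EuclideanSpace ℝ (Fin d)))
    (u : EuclideanSpace ℝ (Fin d) → ℝ)
    (g : EuclideanSpace ℝ (Fin d) → EuclideanSpace ℝ (Fin d)) : Prop where
  memLp : MemLp u 2 volume
  memLp_gradient : MemLp g 2 volume
  exists_approx : ∃ φ : ℕ → EuclideanSpace ℝ (Fin d) → ℝ,
    (∀ n, IsTestFunctionOn Ω (φ n)) ∧
    Tendsto (fun n => eLpNorm (fun x => φ n x - u x) 2 volume) atTop (𝓝 0) ∧
    Tendsto (fun n => eLpNorm (fun x => gradient (φ n) x - g x) 2 volume) atTop (𝓝 0)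

/-- `u` is an eigenfunction of the Dirichlet Laplace operator `-Δ` on `Ω` for the eigenvalue
`lam`: `u ∈ H_0^1(Ω)`, `u ≠ 0` and `-Δ u = lam u` weakly in `Ω`. -/
def IsDirichletEigenfunction {d : ℕ} (Ω : Set (EuclideanSpace ℝ (Fin d))) (lam : ℝ)
    (u : EuclideanSpace ℝ (Fin d) → ℝ) : Prop :=
  ¬ u =ᵐ[volume] 0 ∧ ∃ g, MemH10 Ω u g ∧
    ∀ φ, IsTestFunctionOn Ω φ →
      ∫ x, inner ℝ (g x) (gradient φ x) = lam * ∫ x, u x * φ x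

/-- The ball `B_{1/2}(0)` in `ℝ^d`. -/
def halfBall (d : ℕ) : Set (EuclideanSpace ℝ (Fin d)) := Metric.ball 0 (1 / 2)

/-- The smallest eigenvalue of the Dirichlet Laplace operator `-Δ` on `B_{1/2}(0)`. -/
def lambdaMin (d : ℕ) : ℝ :=
  sInf {lam : ℝ | ∃ u, IsDirichletEigenfunction (halfBall d) lam u}

/-- `H` is an `L²`-normalized positive eigenfunction of `-Δ` on `B_{1/2}(0)` for the smallest
eigenvalue (extended by zero). -/
structure IsGroundState (d : ℕ) (H : EuclideanSpace ℝ (Fin d) → ℝ) : Prop where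
  eigenfunction : IsDirichletEigenfunction (halfBall d) (lambdaMin d) H
  normalized : ∫ x, H x ^ 2 = 1
  pos : ∀ᵐ x ∂volume, x ∈ halfBall d → 0 < H x

/-- The Fourier transform `(2π)^{-d/2} ∫ H(x) e^{-i ω⬝x} dx`. -/
def fourierUnitary {d : ℕ} (H : EuclideanSpace ℝ (Fin d) → ℝ)
    (ω : EuclideanSpace ℝ (Fin d)) : ℂ :=
  (((2 * Real.pi) ^ (-(d : ℝ) / 2) : ℝ) : ℂ) *
    ∫ x, (H x : ℂ) * Complex.exp (-Complex.I * ((inner ℝ ω x : ℝ) : ℂ))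

/-- `β = (2π)^{d/2} (min_{|ω| ≤ π} h(ω))²` with `h` the (real-valued) Fourier transform
of `H`. -/
def betaConst {d : ℕ} (H : EuclideanSpace ℝ (Fin d) → ℝ) : ℝ :=
  (2 * Real.pi) ^ ((d : ℝ) / 2) *
    (sInf ((fun ω => (fourierUnitary H ω).re) '' Metric.closedBall 0 Real.pi)) ^ 2

/-- The constant `c₀ = √2 λ_min^{1/2}`. -/
def cZero (d : ℕ) : ℝ := Real.sqrt 2 * Real.sqrt (lambdaMin d)

/-- The constant `c₁ = π^{d/2} / (2 λ_min^{d/2})`. -/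
def cOne (d : ℕ) : ℝ :=
  Real.pi ^ ((d : ℝ) / 2) / (2 * lambdaMin d ^ ((d : ℝ) / 2))

/-- The constant `c₂ = (2/π)^{d/2} / β`. -/
def cTwo {d : ℕ} (H : EuclideanSpace ℝ (Fin d) → ℝ) : ℝ :=
  (2 / Real.pi) ^ ((d : ℝ) / 2) * (1 / betaConst H)

/-- `∫_{B_R(x₀)} |∑_{x ∈ X} α_x e^{i ω⬝x}|² dω`. -/
def ballIntegral {d : ℕ} (X : Finset (EuclideanSpace ℝ (Fin d))) (α : EuclideanSpace ℝ X)
    (x₀ : EuclideanSpace ℝ (Fin d)) (R : ℝ) : ℝ :=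
  ∫ ω in Metric.ball x₀ R,
    ‖∑ x : X, (α x : ℂ) *
      Complex.exp (Complex.I * ((inner ℝ ω (x : EuclideanSpace ℝ (Fin d)) : ℝ) : ℂ))‖ ^ 2

/-- The separation distance `q_X = min_{x ≠ y ∈ X} |x - y|`. It takes the value `0` if `X` has
at most one point; then `c / q_X = 0`, in accordance with the convention `q_X = ∞`. -/
def sepDist {d : ℕ} (X : Finset (EuclideanSpace ℝ (Fin d))) : ℝ :=
  (X : Set (EuclideanSpace ℝ (Fin d))).infsep

end

/-! After rescaling, the frequencies y_j are 1-separated. Let H be the normalized ground state,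
extended by zero from a ball of diameter 1. The translates H(· + y_j) have disjoint supports, so
Plancherel applied to ∑ c_j H(· + y_j) gives ∫ |𝓕H|² |S|² = ∑ |c_j|² with S the exponential sum
(`integral_fourier_sq_mul_exp_sum`). The partial derivatives of H have the same support property,
and ∫ |∇H|² = λ, so ∫ |η|² |𝓕H|² |S|² = λ/(4π²) ∑ |c_j|².

Upper bound: the first identity and a positive lower bound of |𝓕H| on the ball of radius 1/2 (radius
π in the unitary convention); there the phase stays below π/2, so the cosine in the integral is
positive on the support of H.

Lower bound: |𝓕H| ≤ ‖H‖₁ ≤ 1, and (ρ² - |η|²)|𝓕H|² is at most ρ² inside the ball of radius ρ and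
nonpositive outside. Hence ρ² ∫_{B_ρ} |S|² ≥ (ρ² - λ/(4π²)) ∑ |c_j|²; the choice ρ² = λ/(2π²) leaves
the factor 1/2.

The ground state is explicit: x ↦ ₀F₁(d/2; -c|x|²), with c placing the first zero on the sphere |x|
= 1/2. No spectral theory is needed to see that its eigenvalue is the smallest one: Picone's
inequality `picone_inequality` bounds the Rayleigh quotient of every test function from below by the
eigenvalue of a positive solution, and both this bound and the energy identity extend to H_0^1 by
density. Finally c₀ ≥ π, that is 2λ ≥ π², comes from an elementary lower bound for the first zero.
-/

noncomputable section

/-! ### Plancherel on L¹ ∩ L² and orthogonality of separated exponentials -/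

open FourierTransform in
/-- On `L¹ ∩ L²` the Fourier integral represents the `L²` Fourier transform. -/
theorem fourier_toLp_ae_eq {d : ℕ} {f : EuclideanSpace ℝ (Fin d) → ℂ}
    (hf : Integrable f) (hf2 : MemLp f 2 volume) :
    ((𝓕 (hf2.toLp f) : Lp ℂ 2 (volume : Measure (EuclideanSpace ℝ (Fin d)))) :
      EuclideanSpace ℝ (Fin d) → ℂ) =ᵐ[volume] 𝓕 f := by
  have hcont : Continuous (𝓕 f) :=
    VectorFourier.fourierIntegral_continuous Real.continuous_fourierChar
      continuous_inner hf
  refine ae_eq_of_integral_contDiff_smul_eq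
    ((Lp.memLp _).locallyIntegrable (by norm_num)) hcont.locallyIntegrable ?_
  intro g hg hgc
  set G : SchwartzMap (EuclideanSpace ℝ (Fin d)) ℂ :=
    (hgc.comp_left (g := ((↑) : ℝ → ℂ)) rfl).toSchwartzMap
      (Complex.ofRealCLM.contDiff.comp hg) with hG
  have hGx : ∀ x, G x = (g x : ℂ) := fun x => rfl
  -- The L² transform agrees with the distributional one, which puts 𝓕 on the test function; `h3`
  -- moves it back to f by self-adjointness of the Fourier integral on L¹.
  have h1 := DFunLike.congr_fun (Lp.fourier_toTemperedDistribution_eq (hf2.toLp f)) G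
  rw [TemperedDistribution.fourier_apply, Lp.toTemperedDistribution_apply,
    Lp.toTemperedDistribution_apply] at h1
  have h2 : ∫ x, (𝓕 G) x • (hf2.toLp f) x = ∫ x, (𝓕 G) x • f x := by
    refine integral_congr_ae ?_
    filter_upwards [hf2.coeFn_toLp] with x hx
    rw [hx]
  have h3 : ∫ x, (𝓕 G) x • f x = ∫ x, G x • 𝓕 f x := by
    have := VectorFourier.integral_bilin_fourierIntegral_eq_flip
      (ContinuousLinearMap.lsmul ℂ ℂ) (L := innerₗ (EuclideanSpace ℝ (Fin d)))
      (μ := volume) (ν := volume)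
      Real.continuous_fourierChar continuous_inner (G.integrable (μ := volume)) hf
    simpa using! this
  calc ∫ x, g x • (𝓕 (hf2.toLp f) : Lp ℂ 2 (volume : Measure (EuclideanSpace ℝ (Fin d)))) x
      = ∫ x, G x • (𝓕 (hf2.toLp f) : Lp ℂ 2 (volume : Measure (EuclideanSpace ℝ (Fin d)))) x := by
        simp [hGx]
    _ = ∫ x, G x • 𝓕 f x := by rw [← h1, h2, h3]
    _ = ∫ x, g x • 𝓕 f x := by simp [hGx]

theorem integral_norm_sq_eq_eLpNorm_sq {α F : Type*} [MeasurableSpace α] [NormedAddCommGroup F]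
    {μ : Measure α} {f : α → F} (hf : MemLp f 2 μ) :
    ∫ x, ‖f x‖ ^ 2 ∂μ = (eLpNorm f 2 μ).toReal ^ 2 := by
  rw [hf.eLpNorm_eq_integral_rpow_norm (by norm_num) (by norm_num)]
  have h : 0 ≤ ∫ x, ‖f x‖ ^ 2 ∂μ := integral_nonneg fun x => by positivity
  rw [ENNReal.toReal_ofReal (by positivity)]
  simp only [ENNReal.toReal_ofNat, Real.rpow_ofNat]
  rw [← Real.rpow_natCast, ← Real.rpow_mul h]
  norm_num

open FourierTransform in
theorem memLp_two_fourier {d : ℕ} {f : EuclideanSpace ℝ (Fin d) → ℂ}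
    (hf : Integrable f) (hf2 : MemLp f 2 volume) : MemLp (𝓕 f) 2 volume :=
  (memLp_congr_ae (fourier_toLp_ae_eq hf hf2)).1 (Lp.memLp _)

open FourierTransform in
/-- Plancherel's theorem for the Fourier integral of functions in `L¹ ∩ L²`. -/
theorem integral_norm_sq_fourier_eq {d : ℕ} {f : EuclideanSpace ℝ (Fin d) → ℂ}
    (hf : Integrable f) (hf2 : MemLp f 2 volume) :
    ∫ ξ, ‖𝓕 f ξ‖ ^ 2 = ∫ x, ‖f x‖ ^ 2 := by
  rw [integral_norm_sq_eq_eLpNorm_sq (memLp_two_fourier hf hf2),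
    integral_norm_sq_eq_eLpNorm_sq hf2,
    ← eLpNorm_congr_ae (fourier_toLp_ae_eq hf hf2), ← Lp.norm_def, Lp.norm_fourier_eq,
    Lp.norm_toLp]

open FourierTransform in
theorem fourier_sum_translate {d : ℕ} {ι : Type*} [Fintype ι]
    {f : EuclideanSpace ℝ (Fin d) → ℂ} (hf : Integrable f)
    (y : ι → EuclideanSpace ℝ (Fin d)) (c : ι → ℂ) (η : EuclideanSpace ℝ (Fin d)) :
    𝓕 (fun x => ∑ j, c j * f (x + y j)) η =
      𝓕 f η * ∑ j, c j * Complex.exp (Complex.I * (2 * Real.pi * inner ℝ η (y j) : ℝ)) := by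
  have h : ∀ j, Integrable fun x => c j * f (x + y j) := fun j =>
    (hf.comp_add_right (y j)).const_mul (c j)
  have h' : ∀ j, 𝓕 (fun x => c j * f (x + y j)) η =
      𝓕 f η * (c j * Complex.exp (Complex.I * (2 * Real.pi * inner ℝ η (y j) : ℝ))) := by
    intro j
    have h1 := congrFun (VectorFourier.fourierIntegral_comp_add_right Real.fourierChar volume
      (innerₗ (EuclideanSpace ℝ (Fin d))) f (y j)) η
    have h2 : 𝓕 (fun x => c j * f (x + y j)) η = c j * 𝓕 (fun x => f (x + y j)) η := by
      simp only [Real.fourier_eq, Circle.smul_def, smul_eq_mul]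
      rw [← integral_const_mul]
      congr 1; ext x; ring
    have h3 : 𝓕 (fun x => f (x + y j)) η =
        Real.fourierChar (inner ℝ (y j) η) • 𝓕 f η := h1
    rw [h2, h3, Circle.smul_def, Real.fourierChar_apply, smul_eq_mul, real_inner_comm]
    push_cast
    ring_nf
  simp only [Finset.mul_sum, ← h']
  simp only [Real.fourier_eq]
  rw [← integral_finsetSum]
  · congr 1; ext x; rw [Finset.smul_sum]
  · intro j _
    exact (Real.fourierIntegral_convergent_iff η).2 (h j)

theorem norm_sq_sum_of_disjoint_support {ι : Type*} [Fintype ι] (z : ι → ℂ)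
    (h : ∀ j k, j ≠ k → z j = 0 ∨ z k = 0) : ‖∑ j, z j‖ ^ 2 = ∑ j, ‖z j‖ ^ 2 := by
  classical
  by_cases hz : ∃ j, z j ≠ 0
  · obtain ⟨j, hj⟩ := hz
    have h0 : ∀ k, k ≠ j → z k = 0 := fun k hk => (h k j hk).resolve_right hj
    rw [Fintype.sum_eq_single j h0, Fintype.sum_eq_single j fun k hk => by simp [h0 k hk]]
  · push Not at hz
    simp [hz]

open FourierTransform in
/-- If `f` lives on a ball of diameter `1` and the frequencies `y j` are `1`-separated, then the
exponential sum is orthogonal with respect to the weight `|𝓕 f|²`. -/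
theorem integral_fourier_sq_mul_exp_sum {d : ℕ} {ι : Type*} [Fintype ι]
    {f : EuclideanSpace ℝ (Fin d) → ℂ} (hf : Integrable f) (hf2 : MemLp f 2 volume)
    (hsupp : ∀ x, x ∉ halfBall d → f x = 0)
    {y : ι → EuclideanSpace ℝ (Fin d)} (hy : ∀ j k, j ≠ k → 1 ≤ dist (y j) (y k)) (c : ι → ℂ) :
    Integrable (fun η => ‖𝓕 f η‖ ^ 2 *
      ‖∑ j, c j * Complex.exp (Complex.I * (2 * Real.pi * inner ℝ η (y j) : ℝ))‖ ^ 2) ∧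
    ∫ η, ‖𝓕 f η‖ ^ 2 *
      ‖∑ j, c j * Complex.exp (Complex.I * (2 * Real.pi * inner ℝ η (y j) : ℝ))‖ ^ 2 =
      (∑ j, ‖c j‖ ^ 2) * ∫ x, ‖f x‖ ^ 2 := by
  set g : EuclideanSpace ℝ (Fin d) → ℂ := fun x => ∑ j, c j * f (x + y j) with hg
  have hg1 : Integrable g := integrable_finsetSum _ fun j _ =>
    (hf.comp_add_right (y j)).const_mul (c j)
  have hg2 : MemLp g 2 volume := memLp_finsetSum _ fun j _ =>
    (hf2.comp_measurePreserving (measurePreserving_add_right volume (y j))).const_mul (c j)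
  have hF : ∀ η, ‖𝓕 f η‖ ^ 2 *
      ‖∑ j, c j * Complex.exp (Complex.I * (2 * Real.pi * inner ℝ η (y j) : ℝ))‖ ^ 2 =
      ‖𝓕 g η‖ ^ 2 := fun η => by
    rw [hg, fourier_sum_translate hf y c η, norm_mul, mul_pow]
  simp only [hF]
  refine ⟨(memLp_two_fourier hg1 hg2).integrable_norm_pow (by norm_num), ?_⟩
  rw [integral_norm_sq_fourier_eq hg1 hg2]
  -- No cross terms: if x + y_j and x + y_k both lie in the open ball of radius 1/2, then y_j and
  -- y_k are at distance less than 1.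
  have hpt : ∀ x, ‖g x‖ ^ 2 = ∑ j, ‖c j‖ ^ 2 * ‖f (x + y j)‖ ^ 2 := by
    intro x
    rw [hg]
    simp only
    rw [norm_sq_sum_of_disjoint_support]
    · simp [mul_pow]
    · intro j k hjk
      by_contra! hne
      have h1 : x + y j ∈ halfBall d := by
        by_contra h; exact hne.1 (by rw [hsupp _ h, mul_zero])
      have h2 : x + y k ∈ halfBall d := by
        by_contra h; exact hne.2 (by rw [hsupp _ h, mul_zero])
      simp only [halfBall, Metric.mem_ball, dist_zero_right] at h1 h2
      have h3 := hy j k hjk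
      rw [dist_eq_norm] at h3
      have h4 : y j - y k = (x + y j) - (x + y k) := by abel
      rw [h4] at h3
      linarith [norm_sub_le (x + y j) (x + y k)]
  simp only [hpt]
  have hi : Integrable fun x => ‖f x‖ ^ 2 := hf2.integrable_norm_pow (by norm_num)
  rw [integral_finsetSum _ fun j _ => (hi.comp_add_right (y j)).const_mul _, Finset.sum_mul]
  refine Finset.sum_congr rfl fun j _ => ?_
  rw [integral_const_mul, integral_add_right_eq_self (fun x => ‖f x‖ ^ 2)]

/-! ### The series ₀F₁(m; -t) -/

/-- Coefficients of the hypergeometric series `₀F₁(m; -t)`. -/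
def besselCoeff (m : ℝ) (k : ℕ) : ℝ :=
  (-1) ^ k / (k.factorial * ∏ j ∈ Finset.range k, (m + j))

/-- The entire function `t ↦ ₀F₁(m; -t)`; up to scaling, `x ↦ ₀F₁(d/2; -|x|²)` is the radial
solution of the Helmholtz equation in `ℝ^d`. -/
def besselSeries (m t : ℝ) : ℝ := ∑' k, besselCoeff m k * t ^ k

theorem abs_besselCoeff_le {m : ℝ} (hm : 0 < m) (k : ℕ) :
    |besselCoeff m k| ≤ (1 / m) ^ k / k.factorial := by
  have h : m ^ k ≤ ∏ j ∈ Finset.range k, (m + j) := by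
    calc m ^ k = ∏ _j ∈ Finset.range k, m := by simp
      _ ≤ _ := Finset.prod_le_prod (fun _ _ => hm.le) fun j _ => by
        linarith [(Nat.cast_nonneg j : (0 : ℝ) ≤ j)]
  have hk : (0 : ℝ) < k.factorial := by positivity
  have hp : 0 < m ^ k := by positivity
  rw [besselCoeff, abs_div, abs_pow, abs_neg, abs_one, one_pow,
    abs_of_pos (mul_pos hk (hp.trans_le h)), one_div_pow, div_div, mul_comm (m ^ k)]
  gcongr

theorem summable_abs_besselCoeff {m : ℝ} (hm : 0 < m) (r : ℝ) :
    Summable fun k => |besselCoeff m k| * |r| ^ k := by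
  refine Summable.of_nonneg_of_le (fun k => by positivity) (fun k => ?_)
    (Real.summable_pow_div_factorial (1 / m * |r|))
  rw [mul_pow, mul_div_right_comm]
  gcongr
  exact abs_besselCoeff_le hm k

theorem summable_besselCoeff {m : ℝ} (hm : 0 < m) (t : ℝ) :
    Summable fun k => besselCoeff m k * t ^ k := by
  refine Summable.of_norm ?_
  simpa [abs_mul, abs_pow] using summable_abs_besselCoeff hm t

theorem besselSeries_zero (m : ℝ) : besselSeries m 0 = 1 := by
  rw [besselSeries, tsum_eq_single 0 fun k hk => by simp [hk]]
  simp [besselCoeff]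

theorem prod_range_succ_shift (m : ℝ) (k : ℕ) :
    ∏ j ∈ Finset.range (k + 1), (m + j) = m * ∏ j ∈ Finset.range k, (m + 1 + j) := by
  rw [Finset.prod_range_succ']
  simp only [Nat.cast_add, Nat.cast_one, Nat.cast_zero, add_zero]
  rw [mul_comm]
  congr 1
  refine Finset.prod_congr rfl fun j _ => by ring

theorem prod_range_add_pos {m : ℝ} (hm : 0 < m) (k : ℕ) :
    0 < ∏ j ∈ Finset.range k, (m + j) :=
  Finset.prod_pos fun j _ => by positivity

theorem besselCoeff_succ_mul {m : ℝ} (hm : 0 < m) (k : ℕ) :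
    besselCoeff m (k + 1) * ((k + 1 : ℕ) : ℝ) = -(1 / m) * besselCoeff (m + 1) k := by
  have h1 := (prod_range_add_pos (m := m + 1) (by positivity) k).ne'
  rw [besselCoeff, besselCoeff, prod_range_succ_shift, Nat.factorial_succ, pow_succ]
  push_cast
  field_simp

/-- Termwise differentiation only shifts the parameter, so the family is closed under derivatives.
This yields smoothness by induction over all m at once, and turns the differential equation into a
relation between three neighbouring parameters. -/
theorem hasDerivAt_besselSeries {m : ℝ} (hm : 0 < m) (t : ℝ) :
    HasDerivAt (besselSeries m) (-(1 / m) * besselSeries (m + 1) t) t := by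
  have key : HasDerivAt (fun y => ∑' k, besselCoeff m k * y ^ k)
      (∑' k, besselCoeff m k * (k * t ^ (k - 1))) t := by
    refine hasDerivAt_tsum_of_isPreconnected
      (u := fun k => |besselCoeff m k| * (k * (|t| + 1) ^ (k - 1)))
      (t := Metric.ball 0 (|t| + 1)) ?_ Metric.isOpen_ball
      (convex_ball (0 : ℝ) _).isPreconnected (fun k y _ => (hasDerivAt_pow k y).const_mul _)
      ?_ (y₀ := 0) (by simp; positivity) (summable_besselCoeff hm 0) (by simp)
    · rw [← summable_nat_add_iff 1]
      have h := (summable_abs_besselCoeff (m := m + 1) (by positivity) (|t| + 1)).mul_left (1 / m)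
      refine h.congr fun k => ?_
      have h2 := congrArg abs (besselCoeff_succ_mul hm k)
      rw [abs_mul, Nat.abs_cast, abs_mul, abs_neg, abs_of_pos (by positivity : 0 < 1 / m)] at h2
      rw [abs_of_pos (by positivity : 0 < |t| + 1), Nat.add_sub_cancel, ← mul_assoc, ← mul_assoc,
        h2]
    · intro k y hy
      rw [mem_ball_zero_iff, Real.norm_eq_abs] at hy
      rw [Real.norm_eq_abs, abs_mul, abs_mul, abs_pow, Nat.abs_cast]
      gcongr
  have h3 : ∑' k, besselCoeff m k * (k * t ^ (k - 1)) = -(1 / m) * besselSeries (m + 1) t := by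
    have hs : ∀ k : ℕ, besselCoeff m (k + 1) * ((k + 1 : ℕ) * t ^ (k + 1 - 1)) =
        -(1 / m) * (besselCoeff (m + 1) k * t ^ k) := fun k => by
      rw [← mul_assoc, besselCoeff_succ_mul hm, Nat.add_sub_cancel, mul_assoc]
    rw [tsum_eq_zero_add' (by
      simp only [hs]
      exact (summable_besselCoeff (by positivity) t).mul_left _)]
    simp only [hs, tsum_mul_left, besselSeries]
    simp
  rw [h3] at key
  exact key

theorem deriv_besselSeries {m : ℝ} (hm : 0 < m) :
    deriv (besselSeries m) = fun t => -(1 / m) * besselSeries (m + 1) t :=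
  funext fun t => (hasDerivAt_besselSeries hm t).deriv

theorem contDiff_nat_besselSeries (n : ℕ) :
    ∀ {m : ℝ}, 0 < m → ContDiff ℝ n (besselSeries m) := by
  induction n with
  | zero =>
    intro m hm
    exact contDiff_zero.2
      (continuous_iff_continuousAt.2 fun t => (hasDerivAt_besselSeries hm t).continuousAt)
  | succ n ih =>
    intro m hm
    rw [Nat.cast_add, Nat.cast_one, contDiff_succ_iff_deriv]
    refine ⟨fun t => (hasDerivAt_besselSeries hm t).differentiableAt, by simp, ?_⟩
    rw [deriv_besselSeries hm]
    exact contDiff_const.mul (ih (by positivity))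

theorem contDiff_besselSeries {m : ℝ} (hm : 0 < m) :
    ContDiff ℝ ((⊤ : ℕ∞) : WithTop ℕ∞) (besselSeries m) :=
  contDiff_infty.2 fun n => contDiff_nat_besselSeries n hm

theorem besselSeries_recurrence {m : ℝ} (hm : 0 < m) (t : ℝ) :
    t * (1 / (m * (m + 1)) * besselSeries (m + 2) t) - besselSeries (m + 1) t +
      besselSeries m t = 0 := by
  have h0 := (summable_besselCoeff hm t).tsum_eq_zero_add
  have h1 := (summable_besselCoeff (m := m + 1) (by positivity) t).tsum_eq_zero_add
  have hs0 := (summable_nat_add_iff 1).2 (summable_besselCoeff hm t)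
  have hs1 := (summable_nat_add_iff 1).2 (summable_besselCoeff (m := m + 1) (by positivity) t)
  -- The constant coefficients of both series are 1 and cancel, so the difference starts at degree
  -- one; this accounts for the factor t.
  have e : t * (1 / (m * (m + 1)) * besselSeries (m + 2) t) =
      ∑' k, (besselCoeff (m + 1) (k + 1) * t ^ (k + 1) - besselCoeff m (k + 1) * t ^ (k + 1)) := by
    rw [besselSeries, ← tsum_mul_left, ← tsum_mul_left]
    refine tsum_congr fun k => ?_
    have hP := (prod_range_add_pos (m := m + 2) (by positivity) k).ne'
    have hP0 := (prod_range_add_pos hm (k + 1)).ne'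
    have e1 : ∏ j ∈ Finset.range (k + 1), (m + 1 + j) =
        (m + 1) * ∏ j ∈ Finset.range k, (m + 2 + j) := by
      rw [prod_range_succ_shift]; norm_num [add_assoc]
    have e2 : (∏ j ∈ Finset.range (k + 1), (m + j)) * (m + (k + 1)) =
        m * ((m + 1) * ∏ j ∈ Finset.range k, (m + 2 + j)) := by
      rw [← e1, ← prod_range_succ_shift, Finset.prod_range_succ _ (k + 1)]
      push_cast; ring
    have e3 : ∏ j ∈ Finset.range (k + 1), (m + j) =
        m * ((m + 1) * ∏ j ∈ Finset.range k, (m + 2 + j)) / (m + (k + 1)) := by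
      rw [← e2]; field_simp
    simp only [besselCoeff]
    rw [e1, e3, Nat.factorial_succ, pow_succ, pow_succ]
    push_cast
    field_simp
    ring
  rw [e, hs1.tsum_sub hs0]
  rw [besselSeries, besselSeries, h0, h1]
  simp only [besselCoeff, pow_zero, Nat.factorial_zero, Finset.range_zero, Finset.prod_empty]
  ring

/-- The coefficients are dominated by those of e^{t/m}, so for t ≥ 0 the sum has nonnegative terms,
and the constant term alone is 2. At a zero this forces e^{t/m} ≥ 2. -/
theorem two_le_besselSeries_add_exp {m t : ℝ} (hm : 0 < m) (ht : 0 ≤ t) :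
    2 ≤ besselSeries m t + Real.exp (t / m) := by
  have h1 : HasSum (fun k : ℕ => (t / m) ^ k / k.factorial) (Real.exp (t / m)) := by
    rw [Real.exp_eq_exp_ℝ]
    exact NormedSpace.expSeries_div_hasSum_exp (t / m)
  have h := le_hasSum ((summable_besselCoeff hm t).hasSum.add h1) 0 fun k _ => ?_
  · have h0 : besselCoeff m 0 = 1 := by simp [besselCoeff]
    rw [h0] at h
    norm_num at h
    exact h
  · have h2 := mul_le_mul_of_nonneg_right (neg_le_of_abs_le (abs_besselCoeff_le hm k))
      (pow_nonneg ht k)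
    have h3 : (t / m) ^ k / k.factorial = (1 / m) ^ k / k.factorial * t ^ k := by
      rw [div_pow, div_pow, one_pow]; ring
    rw [h3]
    linarith

/-- The radial Helmholtz equation in the variable `t = |x|²`. -/
theorem besselSeries_ode {m : ℝ} (hm : 0 < m) (t : ℝ) :
    t * deriv (deriv (besselSeries m)) t + m * deriv (besselSeries m) t + besselSeries m t = 0 := by
  have h2 : deriv (deriv (besselSeries m)) t = 1 / (m * (m + 1)) * besselSeries (m + 2) t := by
    rw [deriv_besselSeries hm]
    have h := ((hasDerivAt_besselSeries (m := m + 1) (by positivity) t).const_mul (-(1 / m))).deriv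
    rw [h, add_assoc, one_add_one_eq_two]
    field_simp
  have h1 : m * deriv (besselSeries m) t = - besselSeries (m + 1) t := by
    rw [deriv_besselSeries hm]; field_simp
  rw [h2, h1, ← sub_eq_add_neg]
  exact besselSeries_recurrence hm t

/-! ### Radial solutions of the Helmholtz equation -/

/-- The radial solution `x ↦ ₀F₁(d/2; -c|x|²)` of `-Δ u = 4 c u` on `ℝ^d`. -/
def radialMode (d : ℕ) (c : ℝ) (x : EuclideanSpace ℝ (Fin d)) : ℝ :=
  besselSeries ((d : ℝ) / 2) (c * ‖x‖ ^ 2)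

theorem contDiff_radialMode {d : ℕ} (hd : 1 ≤ d) (c : ℝ) :
    ContDiff ℝ ((⊤ : ℕ∞) : WithTop ℕ∞) (radialMode d c) :=
  (contDiff_besselSeries (by positivity)).comp (contDiff_const.mul (contDiff_norm_sq ℝ))

theorem hasGradientAt_comp_mul_norm_sq {d : ℕ} {A : ℝ → ℝ} {A' c : ℝ}
    {x : EuclideanSpace ℝ (Fin d)} (h : HasDerivAt A A' (c * ‖x‖ ^ 2)) :
    HasGradientAt (fun x => A (c * ‖x‖ ^ 2)) ((2 * c * A') • x) x := by
  rw [hasGradientAt_iff_hasFDerivAt]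
  have h1 := h.comp_hasFDerivAt x ((hasStrictFDerivAt_norm_sq x).hasFDerivAt.const_mul c)
  refine h1.congr_fderiv ?_
  ext v
  simp
  ring

theorem gradient_radialMode {d : ℕ} (hd : 1 ≤ d) (c : ℝ) (x : EuclideanSpace ℝ (Fin d)) :
    gradient (radialMode d c) x =
      (2 * c * deriv (besselSeries ((d : ℝ) / 2)) (c * ‖x‖ ^ 2)) • x :=
  (hasGradientAt_comp_mul_norm_sq (((contDiff_besselSeries (by positivity)).differentiable
    (by simp)) _).hasDerivAt).gradient

theorem continuous_gradient {d : ℕ} {u : EuclideanSpace ℝ (Fin d) → ℝ} (hu : ContDiff ℝ 1 u) :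
    Continuous (gradient u) :=
  (InnerProductSpace.toDual ℝ (EuclideanSpace ℝ (Fin d))).symm.continuous.comp
    (hu.continuous_fderiv (by simp))

theorem hasCompactSupport_gradient {d : ℕ} {u : EuclideanSpace ℝ (Fin d) → ℝ}
    (hu : HasCompactSupport u) : HasCompactSupport (gradient u) :=
  (hu.fderiv (𝕜 := ℝ)).comp_left
    (g := (InnerProductSpace.toDual ℝ (EuclideanSpace ℝ (Fin d))).symm) (map_zero _)

theorem gradient_eq_zero_of_notMem_tsupport {d : ℕ} (u : EuclideanSpace ℝ (Fin d) → ℝ) {x}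
    (hx : x ∉ tsupport u) : gradient u x = 0 := by
  rw [gradient, image_eq_zero_of_notMem_tsupport (fun h => hx (tsupport_fderiv_subset ℝ h)),
    map_zero]

/-- Integration by parts for a gradient against a smooth vector field. -/
theorem integral_inner_gradient_eq_neg_div {d : ℕ} {W φ : EuclideanSpace ℝ (Fin d) → ℝ}
    (hW : ContDiff ℝ 1 W) (hφ : ContDiff ℝ 1 φ) (hφc : HasCompactSupport φ) :
    ∫ x, inner ℝ (W x • x) (gradient φ x) =
      -∫ x, (d * W x + inner ℝ (gradient W x) x) * φ x := by
  have hφ' : ∀ v, Continuous fun x => fderiv ℝ φ x v := fun v =>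
    (hφ.continuous_fderiv (by simp)).clm_apply continuous_const
  have hφc' : ∀ v, HasCompactSupport fun x => fderiv ℝ φ x v := fun v =>
    hφc.fderiv_apply ℝ v
  set V : Fin d → EuclideanSpace ℝ (Fin d) → ℝ := fun i x => W x * x i with hV
  have hproj : ∀ i : Fin d, ContDiff ℝ 1 fun x : EuclideanSpace ℝ (Fin d) => x i := fun i =>
    (EuclideanSpace.proj i : EuclideanSpace ℝ (Fin d) →L[ℝ] ℝ).contDiff
  have hVd : ∀ i, ContDiff ℝ 1 (V i) := fun i => hW.mul (hproj i)
  set e : Fin d → EuclideanSpace ℝ (Fin d) := fun i => EuclideanSpace.single i 1 with he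
  have hV' : ∀ i, Continuous fun x => fderiv ℝ (V i) x (e i) := fun i =>
    ((hVd i).continuous_fderiv (by simp)).clm_apply continuous_const
  have i1 : ∀ i, Integrable fun x => fderiv ℝ (V i) x (e i) * φ x := fun i =>
    ((hV' i).mul hφ.continuous).integrable_of_hasCompactSupport hφc.mul_left
  have i2 : ∀ i, Integrable fun x => V i x * fderiv ℝ φ x (e i) := fun i =>
    ((hVd i).continuous.mul (hφ' _)).integrable_of_hasCompactSupport (hφc' _).mul_left
  have i3 : ∀ i, Integrable fun x => V i x * φ x := fun i =>
    ((hVd i).continuous.mul hφ.continuous).integrable_of_hasCompactSupport hφc.mul_left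
  have hparts : ∀ i, ∫ x, V i x * fderiv ℝ φ x (e i) = -∫ x, fderiv ℝ (V i) x (e i) * φ x :=
    fun i => integral_mul_fderiv_eq_neg_fderiv_mul_of_integrable (i1 i) (i2 i) (i3 i)
      (fun x _ => ((hVd i).differentiable (by simp)) x) (fun x _ => (hφ.differentiable (by simp)) x)
  have hgrad : ∀ (u : EuclideanSpace ℝ (Fin d) → ℝ) x i, gradient u x i = fderiv ℝ u x (e i) := by
    intro u x i
    rw [← inner_gradient_left, he, EuclideanSpace.inner_single_right]
    simp
  have hL : ∀ x, inner ℝ (W x • x) (gradient φ x) = ∑ i, V i x * fderiv ℝ φ x (e i) := by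
    intro x
    rw [PiLp.inner_apply]
    refine Finset.sum_congr rfl fun i _ => ?_
    rw [hgrad]
    simp [hV, mul_comm]
  have hR : ∀ x, (d * W x + inner ℝ (gradient W x) x) * φ x =
      ∑ i, fderiv ℝ (V i) x (e i) * φ x := by
    intro x
    rw [← Finset.sum_mul]
    congr 1
    have h1 : ∀ i, fderiv ℝ (V i) x (e i) = W x + x i * fderiv ℝ W x (e i) := by
      intro i
      have h2 := ((hW.differentiable (by simp)) x).hasFDerivAt.mul
        ((EuclideanSpace.proj i : EuclideanSpace ℝ (Fin d) →L[ℝ] ℝ).hasFDerivAt (x := x))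
      have h3 : fderiv ℝ (V i) x = _ := h2.fderiv
      rw [h3]
      simp [he]
    simp only [h1, Finset.sum_add_distrib]
    rw [PiLp.inner_apply]
    simp [hgrad]
  simp only [hL, hR]
  rw [integral_finsetSum _ fun i _ => i2 i, integral_finsetSum _ fun i _ => i1 i,
    ← Finset.sum_neg_distrib]
  exact Finset.sum_congr rfl fun i _ => hparts i

/-- `radialMode d c` solves `-Δ u = 4 c u` weakly on `ℝ^d`. -/
theorem integral_inner_gradient_radialMode {d : ℕ} (hd : 1 ≤ d) (c : ℝ)
    {φ : EuclideanSpace ℝ (Fin d) → ℝ} (hφ : ContDiff ℝ 1 φ) (hφc : HasCompactSupport φ) :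
    ∫ x, inner ℝ (gradient (radialMode d c) x) (gradient φ x) =
      4 * c * ∫ x, radialMode d c x * φ x := by
  have hm : (0 : ℝ) < d / 2 := by positivity
  set A := besselSeries ((d : ℝ) / 2) with hA
  have hAd : ContDiff ℝ ((⊤ : ℕ∞) : WithTop ℕ∞) (deriv A) :=
    (contDiff_infty_iff_deriv.1 (contDiff_besselSeries hm)).2
  -- The gradient of the mode is the field W(x) x. With t = c|x|², its divergence d W + x·∇W equals
  -- 4c (t A'' + (d/2) A') = -4c A by the ODE.
  set W : EuclideanSpace ℝ (Fin d) → ℝ := fun x => 2 * c * deriv A (c * ‖x‖ ^ 2) with hW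
  have hWd : ContDiff ℝ ((⊤ : ℕ∞) : WithTop ℕ∞) W :=
    contDiff_const.mul (hAd.comp (contDiff_const.mul (contDiff_norm_sq ℝ)))
  have hWg : ∀ x, gradient W x =
      (2 * c * (2 * c * deriv (deriv A) (c * ‖x‖ ^ 2))) • x := fun x =>
    (hasGradientAt_comp_mul_norm_sq (A := fun t => 2 * c * deriv A t)
      (((hAd.differentiable (by simp)) _).hasDerivAt.const_mul (2 * c))).gradient
  simp only [gradient_radialMode hd]
  rw [integral_inner_gradient_eq_neg_div (W := W) (hWd.of_le (by simp)) hφ hφc,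
    ← integral_neg, ← integral_const_mul]
  congr 1
  ext x
  have hode := besselSeries_ode hm (c * ‖x‖ ^ 2)
  rw [hWg, real_inner_smul_left, real_inner_self_eq_norm_sq]
  simp only [hW, radialMode]
  linear_combination -(4 * c * φ x) * hode

/-! ### Picone's inequality and the first zero -/

/-- Barta–Picone inequality: a weak solution of `-Δ U = lam U` that is positive on `Ω` bounds the
Dirichlet Rayleigh quotient on `Ω` from below by `lam`. -/
theorem picone_inequality {d : ℕ} {Ω : Set (EuclideanSpace ℝ (Fin d))}
    {U : EuclideanSpace ℝ (Fin d) → ℝ} {lam : ℝ}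
    (hU : ContDiff ℝ ((⊤ : ℕ∞) : WithTop ℕ∞) U)
    (hweak : ∀ φ, ContDiff ℝ 1 φ → HasCompactSupport φ →
      ∫ x, inner ℝ (gradient U x) (gradient φ x) = lam * ∫ x, U x * φ x)
    (hpos : ∀ x ∈ Ω, 0 < U x) {φ : EuclideanSpace ℝ (Fin d) → ℝ} (hφ : IsTestFunctionOn Ω φ) :
    lam * ∫ x, φ x ^ 2 ≤ ∫ x, ‖gradient φ x‖ ^ 2 := by
  have hU1 : ContDiff ℝ 1 U := hU.of_le (by simp)
  have hφ1 : ContDiff ℝ 1 φ := hφ.contDiff.of_le (by simp)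
  -- Picone's test function, for which ∇U·∇(φ²/U) = |∇φ|² - |∇φ - (φ/U)∇U|². It is C¹ because U > 0
  -- on the support of φ, and it vanishes near every other point.
  set ψ : EuclideanSpace ℝ (Fin d) → ℝ := fun x => φ x ^ 2 / U x with hψ
  have hout : ∀ x, x ∉ tsupport φ → ψ =ᶠ[𝓝 x] 0 := by
    intro x hx
    filter_upwards [notMem_tsupport_iff_eventuallyEq.1 hx] with y hy
    simp [hψ, hy]
  have hψ1 : ContDiff ℝ 1 ψ := by
    rw [contDiff_iff_contDiffAt]
    intro x
    by_cases hx : x ∈ tsupport φ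
    · exact (hφ1.contDiffAt.pow 2).div hU1.contDiffAt (hpos x (hφ.tsupport_subset hx)).ne'
    · exact (contDiffAt_const (c := (0 : ℝ))).congr_of_eventuallyEq (hout x hx)
  have hψc : HasCompactSupport ψ := by
    refine hφ.hasCompactSupport.mono' fun x hx => ?_
    refine subset_tsupport φ ?_
    intro h0
    exact hx (by simp [hψ, h0])
  have hUψ : ∀ x, U x * ψ x = φ x ^ 2 := by
    intro x
    by_cases hx : x ∈ tsupport φ
    · have := (hpos x (hφ.tsupport_subset hx)).ne'
      simp only [hψ]; field_simp
    · simp [hψ, image_eq_zero_of_notMem_tsupport hx]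
  have hpt : ∀ x, inner ℝ (gradient U x) (gradient ψ x) ≤ ‖gradient φ x‖ ^ 2 := by
    intro x
    by_cases hx : x ∈ tsupport φ
    · have hUx := (hpos x (hφ.tsupport_subset hx)).ne'
      have hg : gradient ψ x =
          (2 * (φ x / U x)) • gradient φ x - ((φ x / U x) ^ 2) • gradient U x := by
        refine HasGradientAt.gradient ?_
        rw [hasGradientAt_iff_hasFDerivAt]
        have h1 := ((hφ1.differentiable (by simp) x).hasFDerivAt.pow 2).mul
          ((hasDerivAt_inv hUx).comp_hasFDerivAt x (hU1.differentiable (by simp) x).hasFDerivAt)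
        have h2 : ψ = fun x => φ x ^ 2 * (U x)⁻¹ := by
          ext y; simp [hψ, div_eq_mul_inv]
        rw [h2]
        refine h1.congr_fderiv ?_
        ext v
        simp
        field_simp
        ring
      rw [hg, inner_sub_right, real_inner_smul_right, real_inner_smul_right,
        real_inner_self_eq_norm_sq]
      have h3 := sq_nonneg ‖gradient φ x - (φ x / U x) • gradient U x‖
      have h4 := norm_sub_sq_real (gradient φ x) ((φ x / U x) • gradient U x)
      rw [real_inner_smul_right, norm_smul, mul_pow, Real.norm_eq_abs, sq_abs,
        real_inner_comm] at h4
      have h5 : 0 ≤ ‖gradient φ x - (φ x / U x) • gradient U x‖ ^ 2 := by positivity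
      linarith
    · have h0 : gradient ψ x = 0 := by
        rw [(hout x hx).gradient_eq]
        exact gradient_fun_const x 0
      rw [h0, inner_zero_right]
      positivity
  calc lam * ∫ x, φ x ^ 2 = lam * ∫ x, U x * ψ x := by simp only [hUψ]
    _ = ∫ x, inner ℝ (gradient U x) (gradient ψ x) := (hweak ψ hψ1 hψc).symm
    _ ≤ ∫ x, ‖gradient φ x‖ ^ 2 := by
      refine integral_mono ?_ ?_ hpt
      · refine ((continuous_gradient hU1).inner
          (continuous_gradient hψ1)).integrable_of_hasCompactSupport ?_
        refine (hasCompactSupport_gradient hψc).mono fun x hx h0 => hx ?_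
        simp [h0]
      · refine ((continuous_gradient hφ1).norm.pow 2).integrable_of_hasCompactSupport ?_
        refine (hasCompactSupport_gradient hφ.hasCompactSupport).mono fun x hx h0 => hx ?_
        simp [h0]

/-- The function `₀F₁(d/2; -t)` has a first positive zero. -/
theorem exists_first_zero_besselSeries {d : ℕ} (hd : 1 ≤ d) :
    ∃ c, 0 < c ∧ besselSeries ((d : ℝ) / 2) c = 0 ∧
      ∀ t, 0 ≤ t → t < c → 0 < besselSeries ((d : ℝ) / 2) t := by
  have hm : (0 : ℝ) < d / 2 := by positivity
  set A := besselSeries ((d : ℝ) / 2) with hA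
  have hAc : Continuous A := (contDiff_besselSeries hm).continuous
  have hA0 : A 0 = 1 := besselSeries_zero _
  have hzero : ∃ t, 0 ≤ t ∧ A t = 0 := by
    -- Without a zero, every radial mode would be positive on the whole space, and Picone's
    -- inequality would bound the Rayleigh quotient of one fixed bump function from below by 4c for
    -- every c > 0.
    by_contra! hne
    have hposA : ∀ t, 0 ≤ t → 0 < A t := by
      intro t ht
      by_contra! hle
      obtain ⟨s, hs, hs0⟩ := intermediate_value_Icc' ht hAc.continuousOn
        (show (0 : ℝ) ∈ Set.Icc (A t) (A 0) from ⟨hle, by rw [hA0]; norm_num⟩)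
      exact hne s hs.1 hs0
    let f : ContDiffBump (0 : EuclideanSpace ℝ (Fin d)) := default
    have hf : IsTestFunctionOn Set.univ (f : EuclideanSpace ℝ (Fin d) → ℝ) :=
      ⟨f.contDiff, f.hasCompactSupport, Set.subset_univ _⟩
    have hfpos : 0 < ∫ x, f x ^ 2 := by
      have hcont : Continuous fun x => f x ^ 2 := f.continuous.pow 2
      refine hcont.integral_pos_of_hasCompactSupport_nonneg_nonzero ?_ (fun x => by positivity)
        (x := 0) ?_
      · exact f.hasCompactSupport.mono fun x hx h0 => hx (by simp [h0])
      · rw [f.one_of_mem_closedBall (Metric.mem_closedBall_self f.rIn_pos.le)]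
        norm_num
    set G := ∫ x, ‖gradient (f : EuclideanSpace ℝ (Fin d) → ℝ) x‖ ^ 2
    have hG : 0 ≤ G := integral_nonneg fun x => by positivity
    -- Chosen so that 4c ∫ f² = G + 1 exceeds the energy G.
    set c := (G + 1) / (4 * ∫ x, f x ^ 2) with hc
    have hcpos : 0 < c := by positivity
    have h := picone_inequality (contDiff_radialMode hd c)
      (fun φ h1 h2 => integral_inner_gradient_radialMode hd c h1 h2)
      (Ω := Set.univ) (fun x _ => hposA _ (by positivity)) hf
    have h' : 4 * c * ∫ x, f x ^ 2 = G + 1 := by rw [hc]; field_simp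
    have : 4 * c * ∫ x, f x ^ 2 ≤ G := h
    linarith
  set S := {t : ℝ | 0 ≤ t ∧ A t = 0} with hS
  have hScl : IsClosed S := (isClosed_Ici (a := (0 : ℝ))).inter (isClosed_eq hAc continuous_const)
  have hSb : BddBelow S := ⟨0, fun t ht => ht.1⟩
  have hmem : sInf S ∈ S := hScl.csInf_mem hzero hSb
  refine ⟨sInf S, lt_of_le_of_ne hmem.1 ?_, hmem.2, ?_⟩
  · intro h0
    have := hmem.2
    rw [← h0, hA0] at this
    norm_num at this
  · intro t ht htlt
    by_contra! hle
    obtain ⟨s, hs, hs0⟩ := intermediate_value_Icc' ht hAc.continuousOn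
      (show (0 : ℝ) ∈ Set.Icc (A t) (A 0) from ⟨hle, by rw [hA0]; norm_num⟩)
    exact absurd (csInf_le hSb (show s ∈ S from ⟨hs.1, hs0⟩)) (by linarith [hs.2])

/-! ### Modes of the ball and their membership in H_0^1 -/

/-- A smooth solution of `-Δ U = lam U` on `ℝ^d` which is even, positive on the ball `B_{1/2}(0)`
and zero on its boundary. -/
structure IsBallMode (d : ℕ) (lam : ℝ) (U : EuclideanSpace ℝ (Fin d) → ℝ) : Prop where
  contDiff : ContDiff ℝ ((⊤ : ℕ∞) : WithTop ℕ∞) U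
  weak : ∀ φ, ContDiff ℝ 1 φ → HasCompactSupport φ →
    ∫ x, inner ℝ (gradient U x) (gradient φ x) = lam * ∫ x, U x * φ x
  pos : ∀ x ∈ halfBall d, 0 < U x
  zero_sphere : ∀ x, ‖x‖ = 1 / 2 → U x = 0
  even : ∀ x, U (-x) = U x

theorem volume_halfBall_lt_top (d : ℕ) : volume (halfBall d) < ⊤ := measure_ball_lt_top

theorem isOpen_halfBall (d : ℕ) : IsOpen (halfBall d) := Metric.isOpen_ball

theorem measurableSet_halfBall (d : ℕ) : MeasurableSet (halfBall d) :=
  (isOpen_halfBall d).measurableSet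

theorem exists_bound_on_halfBall {d : ℕ} {F : Type*} [NormedAddCommGroup F]
    {f : EuclideanSpace ℝ (Fin d) → F} (hf : Continuous f) :
    ∃ C, ∀ x ∈ halfBall d, ‖f x‖ ≤ C := by
  obtain ⟨C, hC⟩ := (isCompact_closedBall (0 : EuclideanSpace ℝ (Fin d))
    (1 / 2)).exists_bound_of_continuousOn hf.continuousOn
  exact ⟨C, fun x hx => hC x (Metric.ball_subset_closedBall hx)⟩

theorem memLp_of_bounded_halfBall {d : ℕ} {F : Type*} [NormedAddCommGroup F] (p : ENNReal)
    {f : EuclideanSpace ℝ (Fin d) → F} (hf : AEStronglyMeasurable f volume) {C : ℝ}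
    (hC : ∀ x, ‖f x‖ ≤ C) (h0 : ∀ x, x ∉ halfBall d → f x = 0) : MemLp f p volume := by
  have hi : (halfBall d).indicator f = f := by
    rw [Set.indicator_eq_self]
    intro x hx
    by_contra h
    exact hx (h0 x h)
  rw [← hi, memLp_indicator_iff_restrict (measurableSet_halfBall d)]
  have : IsFiniteMeasure (volume.restrict (halfBall d)) :=
    ⟨by simpa using volume_halfBall_lt_top d⟩
  exact MemLp.of_bound hf.restrict C (ae_of_all _ hC)

theorem integrable_bound_halfBall {d : ℕ} (C : ℝ) :
    Integrable ((halfBall d).indicator fun _ => C) :=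
  (integrable_indicator_iff (measurableSet_halfBall d)).2
    (integrableOn_const (volume_halfBall_lt_top d).ne)

theorem tendsto_eLpNorm_of_bounded_halfBall {d : ℕ} {F : Type*} [NormedAddCommGroup F]
    {f : ℕ → EuclideanSpace ℝ (Fin d) → F} {f' : EuclideanSpace ℝ (Fin d) → F}
    (hf : ∀ n, AEStronglyMeasurable (f n) volume) {C : ℝ} (hC : ∀ n x, ‖f n x‖ ≤ C)
    (h0 : ∀ n x, x ∉ halfBall d → f n x = 0)
    (hlim : ∀ x, Tendsto (fun n => f n x) atTop (𝓝 (f' x))) :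
    Tendsto (fun n => eLpNorm (fun x => f n x - f' x) 2 volume) atTop (𝓝 0) := by
  have hf' : AEStronglyMeasurable f' volume :=
    aestronglyMeasurable_of_tendsto_ae atTop hf (ae_of_all _ hlim)
  have hC' : ∀ x, ‖f' x‖ ≤ C := fun x =>
    le_of_tendsto (hlim x).norm (Eventually.of_forall fun n => hC n x)
  have h0' : ∀ x, x ∉ halfBall d → f' x = 0 := fun x hx =>
    tendsto_nhds_unique (hlim x) (by simp [h0 _ x hx])
  have hm : ∀ n, MemLp (fun x => f n x - f' x) 2 volume := fun n =>
    (memLp_of_bounded_halfBall 2 (hf n) (hC n) (h0 n)).sub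
      (memLp_of_bounded_halfBall 2 hf' hC' h0')
  have hint : Tendsto (fun n => ∫ x, ‖f n x - f' x‖ ^ 2) atTop (𝓝 0) := by
    have h := tendsto_integral_of_dominated_convergence (F := fun n x => ‖f n x - f' x‖ ^ 2)
      (f := fun _ => (0 : ℝ)) (μ := (volume : Measure (EuclideanSpace ℝ (Fin d))))
      ((halfBall d).indicator fun _ => (2 * C) ^ 2) (fun n => ((hf n).sub hf').norm.pow 2)
      (integrable_bound_halfBall _) (fun n => ae_of_all _ fun x => ?_) (ae_of_all _ fun x => ?_)
    · simpa using h
    · by_cases hx : x ∈ halfBall d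
      · rw [Set.indicator_of_mem hx, Real.norm_eq_abs, abs_pow, abs_norm]
        gcongr
        linarith [norm_sub_le (f n x) (f' x), hC n x, hC' x]
      · simp [h0 n x hx, h0' x hx, Set.indicator_of_notMem hx]
    · simpa using ((hlim x).sub_const (f' x)).norm.pow 2
  simp only [integral_norm_sq_eq_eLpNorm_sq (hm _)] at hint
  rw [← ENNReal.tendsto_toReal_iff (fun n => (hm n).eLpNorm_ne_top) ENNReal.zero_ne_top]
  have h := hint.sqrt
  simpa [Real.sqrt_sq ENNReal.toReal_nonneg] using h

/-- A smooth cutoff of the identity of `ℝ` which vanishes on `(-∞, 1]` and is the identity on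
`[2, ∞)`. -/
def cutoffId (s : ℝ) : ℝ := s * Real.smoothTransition (s - 1)

theorem contDiff_cutoffId : ContDiff ℝ ((⊤ : ℕ∞) : WithTop ℕ∞) cutoffId :=
  contDiff_id.mul (Real.smoothTransition.contDiff.comp (contDiff_id.sub contDiff_const))

theorem cutoffId_of_le {s : ℝ} (h : s ≤ 1) : cutoffId s = 0 := by
  rw [cutoffId, Real.smoothTransition.zero_of_nonpos (by linarith), mul_zero]

theorem cutoffId_of_ge {s : ℝ} (h : 2 ≤ s) : cutoffId s = s := by
  rw [cutoffId, Real.smoothTransition.one_of_one_le (by linarith), mul_one]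

theorem abs_cutoffId_le (s : ℝ) : |cutoffId s| ≤ |s| := by
  rw [cutoffId, abs_mul, abs_of_nonneg (Real.smoothTransition.nonneg _)]
  exact mul_le_of_le_one_right (abs_nonneg s) (Real.smoothTransition.le_one _)

theorem deriv_cutoffId_of_gt {s : ℝ} (h : 2 < s) : deriv cutoffId s = 1 := by
  have : cutoffId =ᶠ[𝓝 s] id := by
    filter_upwards [lt_mem_nhds h] with t ht using cutoffId_of_ge ht.le
  rw [this.deriv_eq, deriv_id]

/-- The gradient of ε·cutoffId(U/ε) is cutoffId'(U/ε) ∇U, in which ε cancels; this bound therefore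
makes the gradients of the truncations bounded uniformly in ε. -/
theorem exists_bound_deriv_cutoffId : ∃ K, 0 ≤ K ∧ ∀ s, |deriv cutoffId s| ≤ K := by
  obtain ⟨K, hK⟩ := (isCompact_Icc (a := (1 : ℝ)) (b := 2)).exists_bound_of_continuousOn
    (contDiff_cutoffId.continuous_deriv (by simp)).continuousOn
  refine ⟨max K 1, by positivity, fun s => ?_⟩
  rcases lt_or_ge s 1 with h1 | h1
  · have : cutoffId =ᶠ[𝓝 s] fun _ => 0 := by
      filter_upwards [gt_mem_nhds h1] with t ht using cutoffId_of_le (le_of_lt ht)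
    rw [this.deriv_eq, deriv_const, abs_zero]
    positivity
  · rcases le_or_gt s 2 with h2 | h2
    · exact (hK s ⟨h1, h2⟩).trans (le_max_left _ _)
    · rw [deriv_cutoffId_of_gt h2, abs_one]
      exact le_max_right _ _

theorem IsTestFunctionOn.eq_zero_of_notMem {d : ℕ} {Ω : Set (EuclideanSpace ℝ (Fin d))}
    {φ : EuclideanSpace ℝ (Fin d) → ℝ} (h : IsTestFunctionOn Ω φ) {x} (hx : x ∉ Ω) : φ x = 0 :=
  image_eq_zero_of_notMem_tsupport fun h' => hx (h.tsupport_subset h')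

theorem IsTestFunctionOn.gradient_eq_zero_of_notMem {d : ℕ} {Ω : Set (EuclideanSpace ℝ (Fin d))}
    {φ : EuclideanSpace ℝ (Fin d) → ℝ} (h : IsTestFunctionOn Ω φ) {x} (hx : x ∉ Ω) :
    gradient φ x = 0 :=
  gradient_eq_zero_of_notMem_tsupport φ fun h' => hx (h.tsupport_subset h')

theorem IsTestFunctionOn.memLp {d : ℕ} {Ω : Set (EuclideanSpace ℝ (Fin d))}
    {φ : EuclideanSpace ℝ (Fin d) → ℝ} (h : IsTestFunctionOn Ω φ) : MemLp φ 2 volume :=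
  h.contDiff.continuous.memLp_of_hasCompactSupport h.hasCompactSupport

theorem IsTestFunctionOn.continuous_gradient {d : ℕ} {Ω : Set (EuclideanSpace ℝ (Fin d))}
    {φ : EuclideanSpace ℝ (Fin d) → ℝ} (h : IsTestFunctionOn Ω φ) : Continuous (gradient φ) :=
  _root_.continuous_gradient (h.contDiff.of_le (by simp))

theorem IsTestFunctionOn.memLp_gradient {d : ℕ} {Ω : Set (EuclideanSpace ℝ (Fin d))}
    {φ : EuclideanSpace ℝ (Fin d) → ℝ} (h : IsTestFunctionOn Ω φ) : MemLp (gradient φ) 2 volume :=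
  h.continuous_gradient.memLp_of_hasCompactSupport (hasCompactSupport_gradient h.hasCompactSupport)

namespace IsBallMode
variable {d : ℕ} {lam : ℝ} {U : EuclideanSpace ℝ (Fin d) → ℝ}

theorem differentiable (h : IsBallMode d lam U) : Differentiable ℝ U :=
  h.contDiff.differentiable (by simp)

theorem continuous_gradient (h : IsBallMode d lam U) : Continuous (gradient U) :=
  _root_.continuous_gradient (h.contDiff.of_le (by simp))

/-- Near a point of the sphere U/ε stays below 1 by continuity, so the cutoff kills it; outside the
closed ball the indicator does. Hence the truncation is smooth and supported in the open ball. -/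
theorem truncation_eventuallyEq_zero (h : IsBallMode d lam U) (ε : ℝ)
    {x : EuclideanSpace ℝ (Fin d)} (hx : x ∉ halfBall d) :
    (halfBall d).indicator (fun x => ε * cutoffId (U x / ε)) =ᶠ[𝓝 x] 0 := by
  have hx' : 1 / 2 ≤ ‖x‖ := by simpa [halfBall] using hx
  rcases hx'.eq_or_lt with h1 | h1
  · have h2 : U x / ε < 1 := by rw [h.zero_sphere x h1.symm]; simp
    filter_upwards [(h.contDiff.continuous.div_const ε).continuousAt.eventually_lt_const h2]
      with y hy
    simp [Set.indicator, cutoffId_of_le hy.le]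
  · filter_upwards [continuous_norm.continuousAt.eventually_const_lt h1] with y hy
    have : y ∉ halfBall d := by simpa [halfBall] using hy.le
    simp [Set.indicator_of_notMem this]

theorem isTestFunctionOn_truncation (h : IsBallMode d lam U) (ε : ℝ) :
    IsTestFunctionOn (halfBall d)
      ((halfBall d).indicator fun x => ε * cutoffId (U x / ε)) := by
  have hsub : tsupport ((halfBall d).indicator fun x => ε * cutoffId (U x / ε)) ⊆ halfBall d := by
    intro x hx
    by_contra hn
    exact notMem_tsupport_iff_eventuallyEq.2 (h.truncation_eventuallyEq_zero ε hn) hx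
  refine ⟨?_, ?_, hsub⟩
  · rw [contDiff_iff_contDiffAt]
    intro x
    by_cases hx : x ∈ halfBall d
    · have hs : ContDiff ℝ ((⊤ : ℕ∞) : WithTop ℕ∞) fun x => ε * cutoffId (U x / ε) :=
        contDiff_const.mul (contDiff_cutoffId.comp (h.contDiff.div_const ε))
      refine hs.contDiffAt.congr_of_eventuallyEq ?_
      filter_upwards [(isOpen_halfBall d).mem_nhds hx] with y hy
      exact Set.indicator_of_mem hy _
    · exact (contDiffAt_const (c := (0 : ℝ))).congr_of_eventuallyEq
        (h.truncation_eventuallyEq_zero ε hx)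
  · exact HasCompactSupport.of_support_subset_isCompact
      (isCompact_closedBall (0 : EuclideanSpace ℝ (Fin d)) (1 / 2))
      ((subset_tsupport _).trans (hsub.trans Metric.ball_subset_closedBall))

theorem gradient_truncation (h : IsBallMode d lam U) {ε : ℝ} (hε : 0 < ε)
    {x : EuclideanSpace ℝ (Fin d)} (hx : x ∈ halfBall d) :
    gradient ((halfBall d).indicator fun x => ε * cutoffId (U x / ε)) x =
      deriv cutoffId (U x / ε) • gradient U x := by
  have he : ((halfBall d).indicator fun x => ε * cutoffId (U x / ε)) =ᶠ[𝓝 x]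
      fun x => ε * cutoffId (U x * ε⁻¹) := by
    filter_upwards [(isOpen_halfBall d).mem_nhds hx] with y hy
    rw [Set.indicator_of_mem hy, div_eq_mul_inv]
  rw [he.gradient_eq]
  refine HasGradientAt.gradient ?_
  rw [hasGradientAt_iff_hasFDerivAt]
  have h1 := (((contDiff_cutoffId.differentiable (by simp)
    (U x * ε⁻¹)).hasDerivAt).comp_hasFDerivAt x
      ((h.differentiable x).hasFDerivAt.mul_const ε⁻¹)).const_mul ε
  refine h1.congr_fderiv ?_
  ext v
  simp
  field_simp

/-- The truncations are test functions converging boundedly and pointwise, together with their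
gradients. -/
theorem exists_approx (h : IsBallMode d lam U) :
    ∃ φ : ℕ → EuclideanSpace ℝ (Fin d) → ℝ, ∃ C : ℝ,
      (∀ n, IsTestFunctionOn (halfBall d) (φ n)) ∧ (∀ n x, ‖φ n x‖ ≤ C) ∧
      (∀ n x, ‖gradient (φ n) x‖ ≤ C) ∧
      (∀ x, Tendsto (fun n => φ n x) atTop (𝓝 ((halfBall d).indicator U x))) ∧
      ∀ x, Tendsto (fun n => gradient (φ n) x) atTop
        (𝓝 ((halfBall d).indicator (gradient U) x)) := by
  obtain ⟨C₁, hC₁⟩ := exists_bound_on_halfBall h.contDiff.continuous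
  obtain ⟨C₂, hC₂⟩ := exists_bound_on_halfBall h.continuous_gradient
  obtain ⟨K, hK0, hK⟩ := exists_bound_deriv_cutoffId
  have h0 : (0 : EuclideanSpace ℝ (Fin d)) ∈ halfBall d := by simp [halfBall]
  have hC₁0 : 0 ≤ C₁ := (norm_nonneg _).trans (hC₁ 0 h0)
  have hC₂0 : 0 ≤ C₂ := (norm_nonneg _).trans (hC₂ 0 h0)
  set ε : ℕ → ℝ := fun n => 1 / ((n : ℝ) + 1) with hε
  have hεp : ∀ n, 0 < ε n := fun n => by simp only [hε]; positivity
  have htest := fun n => h.isTestFunctionOn_truncation (ε n)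
  -- Positivity of U makes the truncation agree with U, to first order, at each fixed interior point
  -- once n is large; the pointwise limits are then eventually constant.
  have hlarge : ∀ x ∈ halfBall d, ∀ᶠ n in atTop, 2 < U x / ε n := by
    intro x hx
    have h1 := tendsto_one_div_add_atTop_nhds_zero_nat (𝕜 := ℝ)
    filter_upwards [h1.eventually_lt_const (half_pos (h.pos x hx))] with n hn
    rw [lt_div_iff₀ (hεp n)]
    simp only [hε]
    linarith
  refine ⟨fun n => (halfBall d).indicator fun x => ε n * cutoffId (U x / ε n), C₁ + K * C₂,
    htest, ?_, ?_, ?_, ?_⟩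
  · intro n x
    beta_reduce
    by_cases hx : x ∈ halfBall d
    · rw [Set.indicator_of_mem hx, norm_mul, Real.norm_eq_abs, Real.norm_eq_abs,
        abs_of_pos (hεp n)]
      calc ε n * |cutoffId (U x / ε n)| ≤ ε n * |U x / ε n| :=
            mul_le_mul_of_nonneg_left (abs_cutoffId_le _) (hεp n).le
        _ = ‖U x‖ := by
          rw [abs_div, abs_of_pos (hεp n), Real.norm_eq_abs, mul_div_cancel₀ _ (hεp n).ne']
        _ ≤ C₁ + K * C₂ := by linarith [hC₁ x hx, mul_nonneg hK0 hC₂0]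
    · rw [Set.indicator_of_notMem hx, norm_zero]
      positivity
  · intro n x
    by_cases hx : x ∈ halfBall d
    · rw [h.gradient_truncation (hεp n) hx, norm_smul]
      have := mul_le_mul (hK (U x / ε n)) (hC₂ x hx) (norm_nonneg _) hK0
      rw [Real.norm_eq_abs]
      linarith
    · rw [(htest n).gradient_eq_zero_of_notMem hx, norm_zero]
      positivity
  · intro x
    by_cases hx : x ∈ halfBall d
    · refine tendsto_const_nhds.congr' ?_
      filter_upwards [hlarge x hx] with n hn
      rw [Set.indicator_of_mem hx, Set.indicator_of_mem hx, cutoffId_of_ge hn.le,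
        mul_div_cancel₀ _ (hεp n).ne']
    · simp [Set.indicator_of_notMem hx]
  · intro x
    by_cases hx : x ∈ halfBall d
    · refine tendsto_const_nhds.congr' ?_
      filter_upwards [hlarge x hx] with n hn
      rw [Set.indicator_of_mem hx, h.gradient_truncation (hεp n) hx, deriv_cutoffId_of_gt hn,
        one_smul]
    · simp [Set.indicator_of_notMem hx, (htest _).gradient_eq_zero_of_notMem hx]

theorem memH10 (h : IsBallMode d lam U) :
    MemH10 (halfBall d) ((halfBall d).indicator U) ((halfBall d).indicator (gradient U)) := by
  obtain ⟨C₁, hC₁⟩ := exists_bound_on_halfBall h.contDiff.continuous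
  obtain ⟨C₂, hC₂⟩ := exists_bound_on_halfBall h.continuous_gradient
  have : IsFiniteMeasure (volume.restrict (halfBall d)) :=
    ⟨by simpa using volume_halfBall_lt_top d⟩
  refine ⟨?_, ?_, ?_⟩
  · rw [memLp_indicator_iff_restrict (measurableSet_halfBall d)]
    exact MemLp.of_bound h.contDiff.continuous.aestronglyMeasurable C₁
      ((ae_restrict_iff' (measurableSet_halfBall d)).2 (ae_of_all _ hC₁))
  · rw [memLp_indicator_iff_restrict (measurableSet_halfBall d)]
    exact MemLp.of_bound h.continuous_gradient.aestronglyMeasurable C₂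
      ((ae_restrict_iff' (measurableSet_halfBall d)).2 (ae_of_all _ hC₂))
  · obtain ⟨φ, C, htest, hb, hb', hl, hl'⟩ := h.exists_approx
    exact ⟨φ, htest,
      tendsto_eLpNorm_of_bounded_halfBall (fun n => (htest n).memLp.1) hb
        (fun n x hx => (htest n).eq_zero_of_notMem hx) hl,
      tendsto_eLpNorm_of_bounded_halfBall (fun n => (htest n).memLp_gradient.1) hb'
        (fun n x hx => (htest n).gradient_eq_zero_of_notMem hx) hl'⟩

theorem weak_indicator (h : IsBallMode d lam U) {φ : EuclideanSpace ℝ (Fin d) → ℝ}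
    (hφ : IsTestFunctionOn (halfBall d) φ) :
    ∫ x, inner ℝ ((halfBall d).indicator (gradient U) x) (gradient φ x) =
      lam * ∫ x, (halfBall d).indicator U x * φ x := by
  have h1 : ∀ x, inner ℝ ((halfBall d).indicator (gradient U) x) (gradient φ x) =
      inner ℝ (gradient U x) (gradient φ x) := by
    intro x
    by_cases hx : x ∈ halfBall d
    · rw [Set.indicator_of_mem hx]
    · rw [hφ.gradient_eq_zero_of_notMem hx, inner_zero_right, inner_zero_right]
  have h2 : ∀ x, (halfBall d).indicator U x * φ x = U x * φ x := by
    intro x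
    by_cases hx : x ∈ halfBall d
    · rw [Set.indicator_of_mem hx]
    · rw [hφ.eq_zero_of_notMem hx, mul_zero, mul_zero]
  simp only [h1, h2]
  exact h.weak φ (hφ.contDiff.of_le (by simp)) hφ.hasCompactSupport

end IsBallMode

/-! ### Rayleigh quotients and the smallest eigenvalue -/

theorem inner_toLp_eq_integral {d : ℕ} {F : Type*} [NormedAddCommGroup F] [InnerProductSpace ℝ F]
    {f g : EuclideanSpace ℝ (Fin d) → F} (hf : MemLp f 2 volume) (hg : MemLp g 2 volume) :
    inner ℝ (hf.toLp f) (hg.toLp g) = ∫ x, inner ℝ (f x) (g x) := by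
  rw [L2.inner_def]
  refine integral_congr_ae ?_
  filter_upwards [hf.coeFn_toLp, hg.coeFn_toLp] with x h1 h2
  rw [h1, h2]

theorem norm_toLp_sq_eq_integral {d : ℕ} {F : Type*} [NormedAddCommGroup F]
    {f : EuclideanSpace ℝ (Fin d) → F} (hf : MemLp f 2 volume) :
    ‖hf.toLp f‖ ^ 2 = ∫ x, ‖f x‖ ^ 2 := by
  rw [Lp.norm_toLp, integral_norm_sq_eq_eLpNorm_sq hf]

/-- A weak Dirichlet solution may be tested with itself. -/
theorem MemH10.energy_identity {d : ℕ} {Ω : Set (EuclideanSpace ℝ (Fin d))} {lam : ℝ}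
    {u : EuclideanSpace ℝ (Fin d) → ℝ}
    {g : EuclideanSpace ℝ (Fin d) → EuclideanSpace ℝ (Fin d)} (h : MemH10 Ω u g)
    (hw : ∀ φ, IsTestFunctionOn Ω φ →
      ∫ x, inner ℝ (g x) (gradient φ x) = lam * ∫ x, u x * φ x) :
    ∫ x, ‖g x‖ ^ 2 = lam * ∫ x, u x ^ 2 := by
  obtain ⟨φ, htest, hl, hl'⟩ := h.exists_approx
  have t1 := (Lp.tendsto_Lp_iff_tendsto_eLpNorm'' φ (fun n => (htest n).memLp) u h.memLp).2 hl
  have t2 := (Lp.tendsto_Lp_iff_tendsto_eLpNorm'' (fun n => gradient (φ n))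
    (fun n => (htest n).memLp_gradient) g h.memLp_gradient).2 hl'
  -- The weak equation tested with the approximants of u itself; continuity of the L² inner product
  -- gives the limit.
  have e : ∀ n, inner ℝ (h.memLp_gradient.toLp g) ((htest n).memLp_gradient.toLp _) =
      lam * inner ℝ (h.memLp.toLp u) ((htest n).memLp.toLp _) := by
    intro n
    rw [inner_toLp_eq_integral, inner_toLp_eq_integral, hw _ (htest n)]
    simp [mul_comm]
  have l1 := (tendsto_const_nhds (x := h.memLp_gradient.toLp g)).inner (𝕜 := ℝ) t2
  have l2 := ((tendsto_const_nhds (x := h.memLp.toLp u)).inner (𝕜 := ℝ) t1).const_mul lam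
  simp only [e] at l1
  have h3 := tendsto_nhds_unique l1 l2
  rw [real_inner_self_eq_norm_sq, real_inner_self_eq_norm_sq, norm_toLp_sq_eq_integral,
    norm_toLp_sq_eq_integral] at h3
  simpa using h3

/-- Lower bounds of the Rayleigh quotient pass from test functions to `H_0^1`. -/
theorem MemH10.rayleigh_le {d : ℕ} {Ω : Set (EuclideanSpace ℝ (Fin d))} {lam : ℝ}
    {u : EuclideanSpace ℝ (Fin d) → ℝ}
    {g : EuclideanSpace ℝ (Fin d) → EuclideanSpace ℝ (Fin d)} (h : MemH10 Ω u g)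
    (hp : ∀ φ, IsTestFunctionOn Ω φ → lam * ∫ x, φ x ^ 2 ≤ ∫ x, ‖gradient φ x‖ ^ 2) :
    lam * ∫ x, u x ^ 2 ≤ ∫ x, ‖g x‖ ^ 2 := by
  obtain ⟨φ, htest, hl, hl'⟩ := h.exists_approx
  have t1 := (Lp.tendsto_Lp_iff_tendsto_eLpNorm'' φ (fun n => (htest n).memLp) u h.memLp).2 hl
  have t2 := (Lp.tendsto_Lp_iff_tendsto_eLpNorm'' (fun n => gradient (φ n))
    (fun n => (htest n).memLp_gradient) g h.memLp_gradient).2 hl'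
  have h3 := le_of_tendsto_of_tendsto ((t1.norm.pow 2).const_mul lam) (t2.norm.pow 2)
    (Eventually.of_forall fun n => by
      simp only [norm_toLp_sq_eq_integral]
      simpa using hp _ (htest n))
  rw [norm_toLp_sq_eq_integral, norm_toLp_sq_eq_integral] at h3
  simpa using h3

/-- The energy identity turns the Rayleigh bound into lam ∫u² ≤ mu ∫u², and ∫u² > 0 because u is not
almost everywhere zero. -/
theorem IsDirichletEigenfunction.le_eigenvalue {d : ℕ} {Ω : Set (EuclideanSpace ℝ (Fin d))}
    {lam mu : ℝ} {u : EuclideanSpace ℝ (Fin d) → ℝ} (h : IsDirichletEigenfunction Ω mu u)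
    (hp : ∀ φ, IsTestFunctionOn Ω φ → lam * ∫ x, φ x ^ 2 ≤ ∫ x, ‖gradient φ x‖ ^ 2) :
    lam ≤ mu := by
  obtain ⟨hne, g, hg, hw⟩ := h
  have h1 := hg.rayleigh_le hp
  rw [hg.energy_identity hw] at h1
  refine le_of_mul_le_mul_right h1 (lt_of_le_of_ne (integral_nonneg fun x => sq_nonneg _) ?_)
  intro h0
  refine hne ?_
  have h2 := (integral_eq_zero_iff_of_nonneg (fun x => sq_nonneg (u x))
    hg.memLp.integrable_sq).1 h0.symm
  filter_upwards [h2] with x hx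
  simpa using hx

namespace IsBallMode
variable {d : ℕ} {lam : ℝ} {U : EuclideanSpace ℝ (Fin d) → ℝ}

theorem isDirichletEigenfunction (h : IsBallMode d lam U) :
    IsDirichletEigenfunction (halfBall d) lam ((halfBall d).indicator U) := by
  refine ⟨fun h0 => ?_, _, h.memH10, fun φ hφ => h.weak_indicator hφ⟩
  have h1 : volume (halfBall d) = 0 := by
    refine measure_mono_null (fun x hx => ?_) h0
    simp only [Set.mem_compl_iff, Set.mem_ofPred_eq, Set.indicator_of_mem hx]
    exact (h.pos x hx).ne'
  exact (Metric.measure_ball_pos volume (0 : EuclideanSpace ℝ (Fin d))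
    (by norm_num : (0 : ℝ) < 1 / 2)).ne' h1

/-- The mode is itself an eigenfunction, so lam is attained; Picone's inequality with U as
comparison function makes it a lower bound for all eigenvalues. -/
theorem lambdaMin_eq (h : IsBallMode d lam U) : lambdaMin d = lam := by
  refine IsLeast.csInf_eq ⟨⟨_, h.isDirichletEigenfunction⟩, ?_⟩
  rintro mu ⟨u, hu⟩
  exact hu.le_eigenvalue fun φ hφ => picone_inequality h.contDiff h.weak h.pos hφ

theorem const_mul (h : IsBallMode d lam U) {N : ℝ} (hN : 0 < N) :
    IsBallMode d lam fun x => N * U x := by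
  refine ⟨contDiff_const.mul h.contDiff, fun φ h1 h2 => ?_, fun x hx => mul_pos hN (h.pos x hx),
    fun x hx => by rw [h.zero_sphere x hx, mul_zero], fun x => by rw [h.even]⟩
  have hg : ∀ x, gradient (fun x => N * U x) x = N • gradient U x := by
    intro x
    refine HasGradientAt.gradient ?_
    rw [hasGradientAt_iff_hasFDerivAt]
    refine ((h.differentiable x).hasFDerivAt.const_mul N).congr_fderiv ?_
    ext v
    simp
  simp only [hg, real_inner_smul_left, integral_const_mul, h.weak φ h1 h2, mul_assoc]
  ring

end IsBallMode

/-- Existence of a normalized positive Dirichlet mode of the ball `B_{1/2}(0)`. -/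
theorem exists_normalized_ballMode {d : ℕ} (hd : 1 ≤ d) :
    ∃ lam U, 0 < lam ∧ Real.pi ^ 2 ≤ 2 * lam ∧ IsBallMode d lam U ∧ ∫ x, (halfBall d).indicator U x ^ 2 = 1 := by
  obtain ⟨t, ht, ht0, htpos⟩ := exists_first_zero_besselSeries hd
  -- The argument 4t|x|² reaches the first zero t exactly at |x| = 1/2; the eigenvalue is then
  -- 4·(4t).
  set V := radialMode d (4 * t) with hV
  have hmode : IsBallMode d (4 * (4 * t)) V := by
    refine ⟨contDiff_radialMode hd _,
      fun φ h1 h2 => integral_inner_gradient_radialMode hd _ h1 h2, fun x hx => ?_,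
      fun x hx => ?_, fun x => by simp [hV, radialMode]⟩
    · have hx' : ‖x‖ < 1 / 2 := by simpa [halfBall] using hx
      refine htpos _ (by positivity) ?_
      have h4 : ‖x‖ ^ 2 < (1 / 2) ^ 2 := by gcongr
      nlinarith
    · rw [hV, radialMode, hx]
      convert ht0 using 2
      ring
  set S := ∫ x, (halfBall d).indicator V x ^ 2 with hS
  have hSpos : 0 < S := by
    rw [hS, integral_pos_iff_support_of_nonneg (fun x => sq_nonneg _)
      hmode.memH10.memLp.integrable_sq]
    refine (Metric.measure_ball_pos volume (0 : EuclideanSpace ℝ (Fin d))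
      (by norm_num : (0 : ℝ) < 1 / 2)).trans_le (measure_mono fun x hx => ?_)
    have hx' : x ∈ halfBall d := hx
    have := (hmode.pos x hx').ne'
    rw [Function.mem_support, Set.indicator_of_mem hx']
    positivity
  -- At the zero, 2 ≤ e^{2t/d}, so t ≥ (d/2) log 2 and 32 t ≥ 16 log 2 > π².
  have hlarge : Real.pi ^ 2 ≤ 2 * (4 * (4 * t)) := by
    have h1 := two_le_besselSeries_add_exp (m := (d : ℝ) / 2) (by positivity) ht.le
    rw [ht0, zero_add, ← Real.log_le_iff_le_exp (by norm_num),
      le_div_iff₀ (by positivity)] at h1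
    have h2 : (1 : ℝ) ≤ d := by exact_mod_cast hd
    have h3 := Real.log_two_gt_d9
    nlinarith [Real.pi_lt_d2, Real.pi_pos]
  refine ⟨_, fun x => (Real.sqrt S)⁻¹ * V x, by positivity, hlarge, hmode.const_mul (by positivity), ?_⟩
  have he : ∀ x, (halfBall d).indicator (fun x => (Real.sqrt S)⁻¹ * V x) x ^ 2 =
      S⁻¹ * (halfBall d).indicator V x ^ 2 := by
    intro x
    rw [Set.indicator_const_mul, mul_pow, inv_pow, Real.sq_sqrt hSpos.le]
  simp only [he, integral_const_mul]
  exact inv_mul_cancel₀ hSpos.ne'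

theorem IsBallMode.isGroundState {d : ℕ} {lam : ℝ} {U : EuclideanSpace ℝ (Fin d) → ℝ}
    (h : IsBallMode d lam U) (hN : ∫ x, (halfBall d).indicator U x ^ 2 = 1) :
    IsGroundState d ((halfBall d).indicator U) := by
  refine ⟨?_, hN, ae_of_all _ fun x hx => ?_⟩
  · rw [h.lambdaMin_eq]
    exact h.isDirichletEigenfunction
  · rw [Set.indicator_of_mem hx]
    exact h.pos x hx

/-! ### Fourier transform of the gradient -/

open FourierTransform in
theorem fourier_gradient_testFunction {d : ℕ} {Ω : Set (EuclideanSpace ℝ (Fin d))}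
    {φ : EuclideanSpace ℝ (Fin d) → ℝ} (hφ : IsTestFunctionOn Ω φ) (i : Fin d)
    (η : EuclideanSpace ℝ (Fin d)) :
    𝓕 (fun x => (gradient φ x i : ℂ)) η =
      2 * Real.pi * Complex.I * η i * 𝓕 (fun x => (φ x : ℂ)) η := by
  set f : EuclideanSpace ℝ (Fin d) → ℂ := fun x => (φ x : ℂ) with hf
  have hfd : ContDiff ℝ 1 f := Complex.ofRealCLM.contDiff.comp (hφ.contDiff.of_le (by simp))
  have hfc : HasCompactSupport f := hφ.hasCompactSupport.comp_left (g := ((↑) : ℝ → ℂ)) rfl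
  have i1 : Integrable f := hfd.continuous.integrable_of_hasCompactSupport hfc
  have i2 : Integrable (fderiv ℝ f) :=
    (hfd.continuous_fderiv (by simp)).integrable_of_hasCompactSupport (hfc.fderiv (𝕜 := ℝ))
  have e : ∀ x, (gradient φ x i : ℂ) = fderiv ℝ f x (EuclideanSpace.single i 1) := by
    intro x
    have h1 : HasFDerivAt f (Complex.ofRealCLM.comp (fderiv ℝ φ x)) x :=
      Complex.ofRealCLM.hasFDerivAt.comp x
        ((hφ.contDiff.differentiable (by simp)) x).hasFDerivAt
    rw [h1.fderiv, ContinuousLinearMap.comp_apply, ← inner_gradient_left,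
      EuclideanSpace.inner_single_right]
    simp
  simp only [e]
  rw [← Real.fourier_continuousLinearMap_apply i2,
    Real.fourier_fderiv i1 (hfd.differentiable (by simp)) i2]
  have h2 : innerSL ℝ η (EuclideanSpace.single i 1) = η i := by
    simp [EuclideanSpace.inner_single_right]
  simp only [VectorFourier.fourierSMulRight_apply, neg_apply, h2]
  simp
  ring

open FourierTransform in
theorem tendsto_fourier_of_bounded_halfBall {d : ℕ}
    {f : ℕ → EuclideanSpace ℝ (Fin d) → ℂ} {f' : EuclideanSpace ℝ (Fin d) → ℂ}
    (hf : ∀ n, Continuous (f n)) {C : ℝ} (hC : ∀ n x, ‖f n x‖ ≤ C)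
    (h0 : ∀ n x, x ∉ halfBall d → f n x = 0)
    (hlim : ∀ x, Tendsto (fun n => f n x) atTop (𝓝 (f' x))) (η : EuclideanSpace ℝ (Fin d)) :
    Tendsto (fun n => 𝓕 (f n) η) atTop (𝓝 (𝓕 f' η)) := by
  simp only [Real.fourier_eq]
  refine tendsto_integral_of_dominated_convergence ((halfBall d).indicator fun _ => C)
    (fun n => ?_) (integrable_bound_halfBall C) (fun n => ae_of_all _ fun x => ?_)
    (ae_of_all _ fun x => (hlim x).const_smul _)
  · refine Continuous.aestronglyMeasurable ?_
    simp only [Circle.smul_def]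
    exact (continuous_subtype_val.comp (Real.continuous_fourierChar.comp (by fun_prop))).smul (hf n)
  · rw [Circle.norm_smul]
    by_cases hx : x ∈ halfBall d
    · rw [Set.indicator_of_mem hx]
      exact hC n x
    · simp [h0 n x hx, Set.indicator_of_notMem hx]

-- The zero extension of U need not be differentiable across the sphere, so the rule is proved for
-- the truncations and passed to the limit by dominated convergence.
open FourierTransform in
theorem IsBallMode.fourier_gradient {d : ℕ} {lam : ℝ} {U : EuclideanSpace ℝ (Fin d) → ℝ}
    (h : IsBallMode d lam U) (i : Fin d) (η : EuclideanSpace ℝ (Fin d)) :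
    𝓕 (fun x => (((halfBall d).indicator (gradient U) x i : ℝ) : ℂ)) η =
      2 * Real.pi * Complex.I * η i * 𝓕 (fun x => (((halfBall d).indicator U x : ℝ) : ℂ)) η := by
  obtain ⟨φ, C, htest, hb, hb', hl, hl'⟩ := h.exists_approx
  have t1 := tendsto_fourier_of_bounded_halfBall (f := fun n x => (φ n x : ℂ))
    (fun n => Complex.continuous_ofReal.comp (htest n).contDiff.continuous) (C := C)
    (fun n x => by simpa using hb n x) (fun n x hx => by simp [(htest n).eq_zero_of_notMem hx])
    (fun x => (Complex.continuous_ofReal.tendsto _).comp (hl x)) η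
  have t2 := tendsto_fourier_of_bounded_halfBall (f := fun n x => (gradient (φ n) x i : ℂ))
    (fun n => Complex.continuous_ofReal.comp
      ((EuclideanSpace.proj i : EuclideanSpace ℝ (Fin d) →L[ℝ] ℝ).continuous.comp
        (htest n).continuous_gradient)) (C := C)
    (fun n x => by
      rw [Complex.norm_real]
      exact (PiLp.norm_apply_le (gradient (φ n) x) i).trans (hb' n x))
    (fun n x hx => by simp [(htest n).gradient_eq_zero_of_notMem hx])
    (fun x => (Complex.continuous_ofReal.tendsto _).comp
      (((EuclideanSpace.proj i : EuclideanSpace ℝ (Fin d) →L[ℝ] ℝ).continuous.tendsto _).comp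
        (hl' x))) η
  simp only [fourier_gradient_testFunction (htest _)] at t2
  exact tendsto_nhds_unique t2 (t1.const_mul _)

/-! ### Bounds for exponential sums with 1-separated frequencies -/

theorem volume_halfBall_le_one (d : ℕ) : volume (halfBall d) ≤ 1 := by
  have hmp := EuclideanSpace.volume_preserving_symm_measurableEquiv_toLp (Fin d)
  set S : Set (Fin d → ℝ) := Set.univ.pi fun _ => Set.Ioo (-(1 / 2)) (1 / 2) with hS
  have hSm : MeasurableSet S := MeasurableSet.univ_pi fun _ => measurableSet_Ioo
  calc volume (halfBall d)
      ≤ volume ((MeasurableEquiv.toLp 2 (Fin d → ℝ)).symm ⁻¹' S) := by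
        refine measure_mono fun x hx i _ => ?_
        have hx' : ‖x‖ < 1 / 2 := by simpa [halfBall] using hx
        have h := (PiLp.norm_apply_le x i).trans_lt hx'
        rw [Real.norm_eq_abs, abs_lt] at h
        exact h
    _ = volume S := hmp.measure_preimage hSm.nullMeasurableSet
    _ = 1 := by
        rw [hS, Real.volume_pi_Ioo]
        norm_num

theorem measureReal_halfBall_le_one (d : ℕ) : volume.real (halfBall d) ≤ 1 :=
  ENNReal.toReal_le_of_le_ofReal zero_le_one (by simpa using volume_halfBall_le_one d)

theorem continuous_exp_sum {d : ℕ} {ι : Type*} [Fintype ι] (y : ι → EuclideanSpace ℝ (Fin d))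
    (c : ι → ℂ) : Continuous fun η : EuclideanSpace ℝ (Fin d) =>
      ‖∑ j, c j * Complex.exp (Complex.I * (2 * Real.pi * inner ℝ η (y j) : ℝ))‖ ^ 2 := by
  fun_prop

namespace IsBallMode
variable {d : ℕ} {lam : ℝ} {U : EuclideanSpace ℝ (Fin d) → ℝ}

theorem memLp_indicator (h : IsBallMode d lam U) (p : ENNReal) :
    MemLp ((halfBall d).indicator U) p volume := by
  obtain ⟨C, hC⟩ := exists_bound_on_halfBall h.contDiff.continuous
  have : IsFiniteMeasure (volume.restrict (halfBall d)) :=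
    ⟨by simpa using volume_halfBall_lt_top d⟩
  rw [memLp_indicator_iff_restrict (measurableSet_halfBall d)]
  exact MemLp.of_bound h.contDiff.continuous.aestronglyMeasurable C
    ((ae_restrict_iff' (measurableSet_halfBall d)).2 (ae_of_all _ hC))

theorem memLp_indicator_gradient (h : IsBallMode d lam U) (p : ENNReal) :
    MemLp ((halfBall d).indicator (gradient U)) p volume := by
  obtain ⟨C, hC⟩ := exists_bound_on_halfBall h.continuous_gradient
  have : IsFiniteMeasure (volume.restrict (halfBall d)) :=
    ⟨by simpa using volume_halfBall_lt_top d⟩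
  rw [memLp_indicator_iff_restrict (measurableSet_halfBall d)]
  exact MemLp.of_bound h.continuous_gradient.aestronglyMeasurable C
    ((ae_restrict_iff' (measurableSet_halfBall d)).2 (ae_of_all _ hC))

theorem integral_norm_sq_gradient (h : IsBallMode d lam U)
    (hN : ∫ x, (halfBall d).indicator U x ^ 2 = 1) :
    ∫ x, ‖(halfBall d).indicator (gradient U) x‖ ^ 2 = lam := by
  rw [h.memH10.energy_identity fun φ hφ => h.weak_indicator hφ, hN, mul_one]

/-- Integrate |u| ≤ (1 + u²)/2 over the ball, whose volume is at most 1 because it fits in a unit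
cube. -/
theorem integral_norm_le_one (h : IsBallMode d lam U)
    (hN : ∫ x, (halfBall d).indicator U x ^ 2 = 1) :
    ∫ x, ‖(halfBall d).indicator U x‖ ≤ 1 := by
  have i1 : Integrable ((halfBall d).indicator U) := memLp_one_iff_integrable.1 (h.memLp_indicator 1)
  have i2 : Integrable fun x => (halfBall d).indicator U x ^ 2 := h.memH10.memLp.integrable_sq
  have i3 := integrable_bound_halfBall (d := d) 1
  calc ∫ x, ‖(halfBall d).indicator U x‖
      ≤ ∫ x, (1 / 2) * ((halfBall d).indicator (fun _ => (1 : ℝ)) x +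
          (halfBall d).indicator U x ^ 2) := by
        refine integral_mono i1.norm ((i3.add i2).const_mul _) fun x => ?_
        by_cases hx : x ∈ halfBall d
        · simp only [Set.indicator_of_mem hx, Real.norm_eq_abs]
          nlinarith [sq_nonneg (|U x| - 1), sq_abs (U x)]
        · simp [Set.indicator_of_notMem hx]
    _ = (1 / 2) * (volume.real (halfBall d) + 1) := by
        rw [integral_const_mul, integral_add i3 i2, hN,
          integral_indicator_const _ (measurableSet_halfBall d), smul_eq_mul, mul_one]
    _ ≤ 1 := by linarith [measureReal_halfBall_le_one d]

open FourierTransform in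
theorem norm_fourier_le_one (h : IsBallMode d lam U)
    (hN : ∫ x, (halfBall d).indicator U x ^ 2 = 1) (η : EuclideanSpace ℝ (Fin d)) :
    ‖𝓕 (fun x => (((halfBall d).indicator U x : ℝ) : ℂ)) η‖ ≤ 1 := by
  refine (VectorFourier.norm_fourierIntegral_le_integral_norm Real.fourierChar volume
    (innerₗ (EuclideanSpace ℝ (Fin d))) _ η).trans ?_
  simpa only [Complex.norm_real] using h.integral_norm_le_one hN

open FourierTransform in
theorem integral_fourier_sq_mul_exp_sum (h : IsBallMode d lam U)
    (hN : ∫ x, (halfBall d).indicator U x ^ 2 = 1) {ι : Type*} [Fintype ι]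
    {y : ι → EuclideanSpace ℝ (Fin d)} (hy : ∀ j k, j ≠ k → 1 ≤ dist (y j) (y k)) (c : ι → ℂ) :
    Integrable (fun η => ‖𝓕 (fun x => (((halfBall d).indicator U x : ℝ) : ℂ)) η‖ ^ 2 *
      ‖∑ j, c j * Complex.exp (Complex.I * (2 * Real.pi * inner ℝ η (y j) : ℝ))‖ ^ 2) ∧
    ∫ η, ‖𝓕 (fun x => (((halfBall d).indicator U x : ℝ) : ℂ)) η‖ ^ 2 *
      ‖∑ j, c j * Complex.exp (Complex.I * (2 * Real.pi * inner ℝ η (y j) : ℝ))‖ ^ 2 =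
      ∑ j, ‖c j‖ ^ 2 := by
  have i1 : Integrable ((halfBall d).indicator U) := memLp_one_iff_integrable.1 (h.memLp_indicator 1)
  have key := _root_.integral_fourier_sq_mul_exp_sum i1.ofReal (h.memLp_indicator 2).ofReal
    (fun x hx => by simp [Set.indicator_of_notMem hx]) hy c
  refine ⟨key.1, key.2.trans ?_⟩
  simp [hN]

-- Orthogonality is applied to each partial derivative of U, whose transform carries the factor 2πi
-- η_i; summing over i produces 4π²|η|² on one side and ∫ |∇U|² = lam on the other.
open FourierTransform in
theorem integral_norm_sq_mul_fourier_sq_mul_exp_sum (h : IsBallMode d lam U)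
    (hN : ∫ x, (halfBall d).indicator U x ^ 2 = 1) {ι : Type*} [Fintype ι]
    {y : ι → EuclideanSpace ℝ (Fin d)} (hy : ∀ j k, j ≠ k → 1 ≤ dist (y j) (y k)) (c : ι → ℂ) :
    Integrable (fun η => ‖η‖ ^ 2 *
      (‖𝓕 (fun x => (((halfBall d).indicator U x : ℝ) : ℂ)) η‖ ^ 2 *
      ‖∑ j, c j * Complex.exp (Complex.I * (2 * Real.pi * inner ℝ η (y j) : ℝ))‖ ^ 2)) ∧
    ∫ η, ‖η‖ ^ 2 * (‖𝓕 (fun x => (((halfBall d).indicator U x : ℝ) : ℂ)) η‖ ^ 2 *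
      ‖∑ j, c j * Complex.exp (Complex.I * (2 * Real.pi * inner ℝ η (y j) : ℝ))‖ ^ 2) =
      lam / (4 * Real.pi ^ 2) * ∑ j, ‖c j‖ ^ 2 := by
  have i1 : Integrable ((halfBall d).indicator (gradient U)) :=
    memLp_one_iff_integrable.1 (h.memLp_indicator_gradient 1)
  have m2 := h.memLp_indicator_gradient 2
  have key := fun i : Fin d => _root_.integral_fourier_sq_mul_exp_sum
    (f := fun x => (((halfBall d).indicator (gradient U) x i : ℝ) : ℂ))
    ((EuclideanSpace.proj i : EuclideanSpace ℝ (Fin d) →L[ℝ] ℝ).integrable_comp i1).ofReal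
    ((EuclideanSpace.proj i : EuclideanSpace ℝ (Fin d) →L[ℝ] ℝ).comp_memLp' m2).ofReal
    (fun x hx => by simp [Set.indicator_of_notMem hx]) hy c
  simp only [h.fourier_gradient] at key
  have hpt : ∀ η : EuclideanSpace ℝ (Fin d), ∀ z w : ℝ, ‖η‖ ^ 2 * (z ^ 2 * w) =
      1 / (4 * Real.pi ^ 2) * ∑ i, (2 * Real.pi * |η i| * z) ^ 2 * w := by
    intro η z w
    rw [EuclideanSpace.real_norm_sq_eq, ← Finset.sum_mul]
    have : ∀ i, (2 * Real.pi * |η i| * z) ^ 2 = 4 * Real.pi ^ 2 * z ^ 2 * η i ^ 2 := fun i => by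
      rw [mul_pow, mul_pow, sq_abs]; ring
    simp only [this, ← Finset.mul_sum]
    field_simp
  have hnorm : ∀ (η : EuclideanSpace ℝ (Fin d)) (i : Fin d) (z : ℂ),
      ‖2 * Real.pi * Complex.I * η i * z‖ = 2 * Real.pi * |η i| * ‖z‖ := by
    intro η i z
    simp [abs_of_pos Real.pi_pos]
  simp only [hnorm] at key
  simp only [hpt]
  refine ⟨(integrable_finsetSum _ fun i _ => (key i).1).const_mul _, ?_⟩
  rw [integral_const_mul, integral_finsetSum _ fun i _ => (key i).1]
  simp only [(key _).2, ← Finset.mul_sum]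
  rw [← integral_finsetSum]
  · have hn : ∀ x, ∑ i, ‖(((halfBall d).indicator (gradient U) x i : ℝ) : ℂ)‖ ^ 2 =
        ‖(halfBall d).indicator (gradient U) x‖ ^ 2 := fun x => by
      rw [EuclideanSpace.real_norm_sq_eq]
      simp
    simp only [hn, h.integral_norm_sq_gradient hN]
    ring
  · intro i _
    exact ((EuclideanSpace.proj i : EuclideanSpace ℝ (Fin d) →L[ℝ] ℝ).comp_memLp'
      m2).ofReal.integrable_norm_pow (by norm_num)

open FourierTransform in
/-- Upper bound for exponential sums with `1`-separated frequencies on the ball of radius `1/2`. -/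
theorem setIntegral_exp_sum_le (h : IsBallMode d lam U)
    (hN : ∫ x, (halfBall d).indicator U x ^ 2 = 1) {ι : Type*} [Fintype ι]
    {y : ι → EuclideanSpace ℝ (Fin d)} (hy : ∀ j k, j ≠ k → 1 ≤ dist (y j) (y k)) (c : ι → ℂ)
    {m : ℝ} (hm : 0 < m) (hmin : ∀ η ∈ Metric.ball (0 : EuclideanSpace ℝ (Fin d)) (1 / 2),
      m ≤ ‖𝓕 (fun x => (((halfBall d).indicator U x : ℝ) : ℂ)) η‖) :
    ∫ η in Metric.ball (0 : EuclideanSpace ℝ (Fin d)) (1 / 2),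
      ‖∑ j, c j * Complex.exp (Complex.I * (2 * Real.pi * inner ℝ η (y j) : ℝ))‖ ^ 2 ≤
      (m ^ 2)⁻¹ * ∑ j, ‖c j‖ ^ 2 := by
  obtain ⟨i1, e1⟩ := h.integral_fourier_sq_mul_exp_sum hN hy c
  rw [← e1, ← integral_const_mul]
  -- On the ball the weight |𝓕U|²/m² is at least 1; elsewhere it is nonnegative and the domain may
  -- be enlarged.
  refine le_trans (setIntegral_mono_on ?_ (i1.const_mul _).integrableOn measurableSet_ball
    fun η hη => ?_) (setIntegral_le_integral (i1.const_mul _) (ae_of_all _ fun η => ?_))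
  · exact ((continuous_exp_sum y c).continuousOn.integrableOn_compact
      (isCompact_closedBall _ _)).mono_set Metric.ball_subset_closedBall
  · rw [← mul_assoc]
    refine le_mul_of_one_le_left (by positivity) ?_
    rw [← div_eq_inv_mul, one_le_div (by positivity)]
    exact pow_le_pow_left₀ hm.le (hmin η hη) 2
  · show 0 ≤ (m ^ 2)⁻¹ * _
    positivity

open FourierTransform in
/-- Lower bound for exponential sums with `1`-separated frequencies. -/
theorem le_setIntegral_exp_sum (h : IsBallMode d lam U)
    (hN : ∫ x, (halfBall d).indicator U x ^ 2 = 1) {ι : Type*} [Fintype ι]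
    {y : ι → EuclideanSpace ℝ (Fin d)} (hy : ∀ j k, j ≠ k → 1 ≤ dist (y j) (y k)) (c : ι → ℂ)
    {ρ : ℝ} (hρ : 0 < ρ) (hlam : ρ ^ 2 = lam / (2 * Real.pi ^ 2)) :
    1 / 2 * ∑ j, ‖c j‖ ^ 2 ≤ ∫ η in Metric.ball (0 : EuclideanSpace ℝ (Fin d)) ρ,
      ‖∑ j, c j * Complex.exp (Complex.I * (2 * Real.pi * inner ℝ η (y j) : ℝ))‖ ^ 2 := by
  obtain ⟨i1, e1⟩ := h.integral_fourier_sq_mul_exp_sum hN hy c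
  obtain ⟨i2, e2⟩ := h.integral_norm_sq_mul_fourier_sq_mul_exp_sum hN hy c
  set S : EuclideanSpace ℝ (Fin d) → ℝ := fun η =>
    ‖∑ j, c j * Complex.exp (Complex.I * (2 * Real.pi * inner ℝ η (y j) : ℝ))‖ ^ 2 with hS
  set w : EuclideanSpace ℝ (Fin d) → ℝ := fun η =>
    ‖𝓕 (fun x => (((halfBall d).indicator U x : ℝ) : ℂ)) η‖ ^ 2 with hw
  have hS0 : ∀ η, 0 ≤ S η := fun η => by positivity
  have hw0 : ∀ η, 0 ≤ w η := fun η => by positivity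
  have hw1 : ∀ η, w η ≤ 1 := fun η => pow_le_one₀ (norm_nonneg _) (h.norm_fourier_le_one hN η)
  have iS : IntegrableOn S (Metric.ball 0 ρ) :=
    ((continuous_exp_sum y c).continuousOn.integrableOn_compact
      (isCompact_closedBall _ _)).mono_set Metric.ball_subset_closedBall
  -- The weight (ρ² - |η|²) w is at most ρ² inside the ball, since w ≤ 1, and nonpositive outside.
  have key : ∫ η, (ρ ^ 2 * (w η * S η) - ‖η‖ ^ 2 * (w η * S η)) ≤
      ∫ η, (Metric.ball (0 : EuclideanSpace ℝ (Fin d)) ρ).indicator (fun η => ρ ^ 2 * S η) η := by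
    refine integral_mono ((i1.const_mul _).sub i2)
      ((integrable_indicator_iff measurableSet_ball).2 (iS.const_mul _)) fun η => ?_
    have h1 : 0 ≤ w η * S η := mul_nonneg (hw0 η) (hS0 η)
    by_cases hη : η ∈ Metric.ball (0 : EuclideanSpace ℝ (Fin d)) ρ
    · simp only [Set.indicator_of_mem hη]
      have h2 : w η * S η ≤ S η := mul_le_of_le_one_left (hS0 η) (hw1 η)
      nlinarith [mul_nonneg (sq_nonneg ‖η‖) h1, mul_le_mul_of_nonneg_left h2 (sq_nonneg ρ)]
    · simp only [Set.indicator_of_notMem hη]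
      have h2 : ρ ≤ ‖η‖ := by simpa using hη
      have h3 : ρ ^ 2 ≤ ‖η‖ ^ 2 := pow_le_pow_left₀ hρ.le h2 2
      nlinarith [mul_le_mul_of_nonneg_right h3 h1]
  rw [integral_sub (i1.const_mul _) i2, integral_const_mul, e1, e2,
    integral_indicator measurableSet_ball, integral_const_mul] at key
  -- The second moment is exactly half of ρ², so half of the mass remains.
  have h4 : lam / (4 * Real.pi ^ 2) = ρ ^ 2 / 2 := by rw [hlam]; ring
  rw [h4] at key
  refine le_of_mul_le_mul_left (a := ρ ^ 2) ?_ (by positivity)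
  linarith

end IsBallMode

/-! ### The unitary Fourier transform of the ground state -/

theorem rpow_natCast_div_two {x : ℝ} (hx : 0 ≤ x) (d : ℕ) :
    x ^ ((d : ℝ) / 2) = Real.sqrt x ^ d := by
  rw [Real.sqrt_eq_rpow, ← Real.rpow_natCast, ← Real.rpow_mul hx]
  congr 1
  ring

open FourierTransform in
theorem fourierUnitary_two_pi_smul {d : ℕ} (H : EuclideanSpace ℝ (Fin d) → ℝ)
    (η : EuclideanSpace ℝ (Fin d)) :
    fourierUnitary H ((2 * Real.pi) • η) =
      (((2 * Real.pi) ^ (-(d : ℝ) / 2) : ℝ) : ℂ) * 𝓕 (fun x => (H x : ℂ)) η := by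
  rw [fourierUnitary, Real.fourier_eq']
  congr 2
  ext x
  rw [real_inner_smul_left, real_inner_comm, smul_eq_mul, mul_comm]
  congr 2
  push_cast
  ring

theorem fourierUnitary_im_eq_zero {d : ℕ} {H : EuclideanSpace ℝ (Fin d) → ℝ}
    (hH : ∀ x, H (-x) = H x) (ω : EuclideanSpace ℝ (Fin d)) : (fourierUnitary H ω).im = 0 := by
  rw [fourierUnitary, Complex.im_ofReal_mul, mul_eq_zero]
  right
  rw [← Complex.conj_eq_iff_im, ← integral_conj, ← integral_neg_eq_self]
  congr 1
  ext x
  rw [map_mul, Complex.conj_ofReal, hH, ← Complex.exp_conj]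
  simp [inner_neg_right]

theorem fourierUnitary_re {d : ℕ} {H : EuclideanSpace ℝ (Fin d) → ℝ} (hH : Integrable H)
    (ω : EuclideanSpace ℝ (Fin d)) :
    (fourierUnitary H ω).re =
      (2 * Real.pi) ^ (-(d : ℝ) / 2) * ∫ x, H x * Real.cos (inner ℝ ω x) := by
  have hi : Integrable fun x => (H x : ℂ) * Complex.exp (-Complex.I * ((inner ℝ ω x : ℝ) : ℂ)) := by
    refine hH.ofReal.mul_bdd (c := 1) (by fun_prop) (ae_of_all _ fun x => ?_)
    rw [Complex.norm_exp]
    simp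
  rw [fourierUnitary, Complex.re_ofReal_mul]
  congr 1
  have h := integral_re (𝕜 := ℂ) hi
  rw [← RCLike.re_eq_complex_re, ← h]
  congr 1
  ext x
  have e : -Complex.I * ((inner ℝ ω x : ℝ) : ℂ) = ((-inner ℝ ω x : ℝ) : ℂ) * Complex.I := by
    push_cast; ring
  rw [RCLike.re_eq_complex_re, Complex.re_ofReal_mul, e, Complex.exp_ofReal_mul_I_re, Real.cos_neg]

theorem continuous_fourierUnitary_re {d : ℕ} {H : EuclideanSpace ℝ (Fin d) → ℝ}
    (hH : Integrable H) : Continuous fun ω => (fourierUnitary H ω).re := by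
  simp only [fourierUnitary_re hH]
  refine continuous_const.mul (continuous_of_dominated (bound := fun x => ‖H x‖)
    (fun ω => hH.1.mul (by fun_prop)) (fun ω => ae_of_all _ fun x => ?_) hH.norm
    (ae_of_all _ fun x => by fun_prop))
  rw [norm_mul]
  exact mul_le_of_le_one_right (norm_nonneg _) (Real.abs_cos_le_one _)

namespace IsBallMode
variable {d : ℕ} {lam : ℝ} {U : EuclideanSpace ℝ (Fin d) → ℝ}

theorem integrable_indicator (h : IsBallMode d lam U) : Integrable ((halfBall d).indicator U) :=
  memLp_one_iff_integrable.1 (h.memLp_indicator 1)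

theorem fourierUnitary_re_pos (h : IsBallMode d lam U) {ω : EuclideanSpace ℝ (Fin d)}
    (hω : ‖ω‖ ≤ Real.pi) : 0 < (fourierUnitary ((halfBall d).indicator U) ω).re := by
  rw [fourierUnitary_re h.integrable_indicator]
  refine mul_pos (by positivity) ?_
  -- For |ω| ≤ π and |x| < 1/2 the phase is strictly below π/2; this is where the radius π in the
  -- definition of β comes from.
  have hcos : ∀ x ∈ halfBall d, 0 < Real.cos (inner ℝ ω x) := by
    intro x hx
    have hx' : ‖x‖ < 1 / 2 := by simpa [halfBall] using hx
    refine Real.cos_pos_of_mem_Ioo (abs_lt.1 ?_)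
    calc |inner ℝ ω x| ≤ ‖ω‖ * ‖x‖ := abs_real_inner_le_norm _ _
      _ ≤ Real.pi * ‖x‖ := by gcongr
      _ < Real.pi / 2 := by nlinarith [Real.pi_pos]
  rw [integral_pos_iff_support_of_nonneg]
  · refine (Metric.measure_ball_pos volume (0 : EuclideanSpace ℝ (Fin d))
      (by norm_num : (0 : ℝ) < 1 / 2)).trans_le (measure_mono fun x hx => ?_)
    have hx' : x ∈ halfBall d := hx
    rw [Function.mem_support, Set.indicator_of_mem hx']
    exact (mul_pos (h.pos x hx') (hcos x hx')).ne'
  · intro x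
    by_cases hx : x ∈ halfBall d
    · simp only [Set.indicator_of_mem hx]
      exact (mul_pos (h.pos x hx) (hcos x hx)).le
    · simp [Set.indicator_of_notMem hx]
  · refine h.integrable_indicator.mul_bdd (c := 1) (by fun_prop) (ae_of_all _ fun x => ?_)
    exact Real.abs_cos_le_one _

/-- The minimum of the Fourier transform over the ball of radius `π` is positive. -/
theorem sInf_fourierUnitary_pos (h : IsBallMode d lam U) :
    0 < sInf ((fun ω => (fourierUnitary ((halfBall d).indicator U) ω).re) ''
      Metric.closedBall 0 Real.pi) := by
  have hK := (isCompact_closedBall (0 : EuclideanSpace ℝ (Fin d)) Real.pi).image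
    (continuous_fourierUnitary_re h.integrable_indicator)
  obtain ⟨ω, hω, he⟩ := hK.sInf_mem
    ((Metric.nonempty_closedBall.2 Real.pi_pos.le).image _)
  rw [← he]
  exact h.fourierUnitary_re_pos (by simpa using hω)

theorem sInf_le_fourierUnitary_re (h : IsBallMode d lam U) {ω : EuclideanSpace ℝ (Fin d)}
    (hω : ‖ω‖ ≤ Real.pi) :
    sInf ((fun ω => (fourierUnitary ((halfBall d).indicator U) ω).re) ''
      Metric.closedBall 0 Real.pi) ≤ (fourierUnitary ((halfBall d).indicator U) ω).re :=
  csInf_le ((isCompact_closedBall (0 : EuclideanSpace ℝ (Fin d)) Real.pi).image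
    (continuous_fourierUnitary_re h.integrable_indicator)).bddBelow
    (Set.mem_image_of_mem _ (by simpa using hω))

open FourierTransform in
theorem le_norm_fourier (h : IsBallMode d lam U) {η : EuclideanSpace ℝ (Fin d)}
    (hη : ‖η‖ ≤ 1 / 2) :
    Real.sqrt (2 * Real.pi) ^ d *
      sInf ((fun ω => (fourierUnitary ((halfBall d).indicator U) ω).re) ''
        Metric.closedBall 0 Real.pi) ≤
      ‖𝓕 (fun x => (((halfBall d).indicator U x : ℝ) : ℂ)) η‖ := by
  have h1 : ‖(2 * Real.pi) • η‖ ≤ Real.pi := by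
    rw [norm_smul, Real.norm_of_nonneg (by positivity)]
    nlinarith [Real.pi_pos]
  have h2 := (h.sInf_le_fourierUnitary_re h1).trans (Complex.re_le_norm _)
  rw [fourierUnitary_two_pi_smul, norm_mul, Complex.norm_real, Real.norm_of_nonneg (by positivity),
    neg_div, Real.rpow_neg (by positivity), rpow_natCast_div_two (by positivity),
    ← div_eq_inv_mul, le_div_iff₀' (by positivity)] at h2
  exact h2

end IsBallMode

/-! ### Rescaling to 1-separated frequencies and the constants -/

theorem sum_norm_sq_modulated {d : ℕ} {X : Finset (EuclideanSpace ℝ (Fin d))} (α : EuclideanSpace ℝ X)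
    (x₀ : EuclideanSpace ℝ (Fin d)) :
    ∑ x : X, ‖(α x : ℂ) * Complex.exp (Complex.I *
      ((inner ℝ x₀ (x : EuclideanSpace ℝ (Fin d)) : ℝ) : ℂ))‖ ^ 2 = ‖α‖ ^ 2 := by
  rw [EuclideanSpace.real_norm_sq_eq]
  refine Finset.sum_congr rfl fun x _ => ?_
  rw [norm_mul, mul_comm Complex.I, Complex.norm_exp_ofReal_mul_I, mul_one, Complex.norm_real,
    Real.norm_eq_abs, sq_abs]

/-- Recentring and rescaling of `ballIntegral`. -/
theorem ballIntegral_eq {d : ℕ} (X : Finset (EuclideanSpace ℝ (Fin d))) (α : EuclideanSpace ℝ X)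
    (x₀ : EuclideanSpace ℝ (Fin d)) {a : ℝ} (ha : 0 < a) (ρ : ℝ) :
    ballIntegral X α x₀ (a * ρ) = a ^ d * ∫ η in Metric.ball (0 : EuclideanSpace ℝ (Fin d)) ρ,
      ‖∑ x : X, ((α x : ℂ) * Complex.exp (Complex.I *
        ((inner ℝ x₀ (x : EuclideanSpace ℝ (Fin d)) : ℝ) : ℂ))) *
        Complex.exp (Complex.I *
          (2 * Real.pi * inner ℝ η ((a / (2 * Real.pi)) • (x : EuclideanSpace ℝ (Fin d))) : ℝ))‖
        ^ 2 := by
  rw [ballIntegral, ← integral_indicator measurableSet_ball,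
    ← integral_indicator measurableSet_ball]
  set F := (Metric.ball x₀ (a * ρ)).indicator fun ω => ‖∑ x : X, (α x : ℂ) *
      Complex.exp (Complex.I * ((inner ℝ ω (x : EuclideanSpace ℝ (Fin d)) : ℝ) : ℂ))‖ ^ 2 with hF
  have h1 := Measure.integral_comp_smul (volume : Measure (EuclideanSpace ℝ (Fin d)))
    (fun ω => F (x₀ + ω)) a
  rw [integral_add_left_eq_self F x₀, finrank_euclideanSpace_fin, abs_of_pos (by positivity),
    smul_eq_mul] at h1
  have h2 : ∫ ω, F ω = a ^ d * ∫ η, F (x₀ + a • η) := by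
    rw [h1, mul_inv_cancel_left₀ (by positivity)]
  rw [h2]
  congr 2
  ext η
  have hmem : x₀ + a • η ∈ Metric.ball x₀ (a * ρ) ↔ η ∈ Metric.ball 0 ρ := by
    rw [mem_ball_iff_norm, add_sub_cancel_left, norm_smul, Real.norm_of_nonneg ha.le,
      mem_ball_zero_iff, mul_lt_mul_iff_right₀ ha]
  by_cases hη : η ∈ Metric.ball (0 : EuclideanSpace ℝ (Fin d)) ρ
  · rw [hF, Set.indicator_of_mem (hmem.2 hη), Set.indicator_of_mem hη]
    congr 3
    ext x
    rw [mul_assoc, ← Complex.exp_add, ← mul_add, ← Complex.ofReal_add, inner_add_left,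
      real_inner_smul_left, real_inner_smul_right]
    congr 5
    field_simp
  · rw [hF, Set.indicator_of_notMem (fun h => hη (hmem.1 h)), Set.indicator_of_notMem hη]

/-- Two distinct points make `sepDist X` positive, so the convention c / 0 = 0 plays no role here.
It is used with c = π and c = c₀. -/
theorem one_le_dist_smul_of_div_sepDist_le {d : ℕ} {X : Finset (EuclideanSpace ℝ (Fin d))}
    {c R : ℝ} (hc : 0 < c) (h : c / sepDist X ≤ R) (x y : X) (hxy : x ≠ y) :
    1 ≤ dist ((R / c) • (x : EuclideanSpace ℝ (Fin d))) ((R / c) • (y : EuclideanSpace ℝ (Fin d))) := by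
  have hne : (x : EuclideanSpace ℝ (Fin d)) ≠ y := fun h => hxy (Subtype.ext h)
  have h1 : sepDist X ≤ dist (x : EuclideanSpace ℝ (Fin d)) y :=
    Set.infsep_le_dist_of_mem x.2 y.2 hne
  have h2 : 0 < sepDist X :=
    X.finite_toSet.infsep_pos_iff_nontrivial.2 ⟨x, x.2, y, y.2, hne⟩
  rw [div_le_iff₀ h2] at h
  have hR : 0 < R := by
    by_contra! hle
    nlinarith
  rw [dist_smul₀, Real.norm_of_nonneg (by positivity), div_mul_eq_mul_div, le_div_iff₀ hc, one_mul]
  exact h.trans (mul_le_mul_of_nonneg_left h1 hR.le)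

namespace IsBallMode
variable {d : ℕ} {lam : ℝ} {U : EuclideanSpace ℝ (Fin d) → ℝ}

/-- This is the form in which the constant arises: 2^d from the dilation by 2R, times the inverse
square of the lower bound in `le_norm_fourier`. -/
theorem cTwo_eq (h : IsBallMode d lam U) :
    cTwo ((halfBall d).indicator U) = 2 ^ d * ((Real.sqrt (2 * Real.pi) ^ d *
      sInf ((fun ω => (fourierUnitary ((halfBall d).indicator U) ω).re) ''
        Metric.closedBall 0 Real.pi)) ^ 2)⁻¹ := by
  have hm := h.sInf_fourierUnitary_pos
  have h2 : Real.sqrt 2 ^ d * Real.sqrt 2 ^ d = 2 ^ d := by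
    rw [← mul_pow, Real.mul_self_sqrt (by norm_num)]
  rw [cTwo, betaConst, rpow_natCast_div_two (by positivity), rpow_natCast_div_two (by positivity),
    Real.sqrt_div (by norm_num), Real.sqrt_mul (by norm_num), div_pow, mul_pow, ← h2]
  field_simp

theorem cTwo_pos (h : IsBallMode d lam U) : 0 < cTwo ((halfBall d).indicator U) := by
  have hm := h.sInf_fourierUnitary_pos
  rw [h.cTwo_eq]
  positivity

theorem ballIntegral_le (h : IsBallMode d lam U) (hN : ∫ x, (halfBall d).indicator U x ^ 2 = 1)
    (X : Finset (EuclideanSpace ℝ (Fin d))) (x₀ : EuclideanSpace ℝ (Fin d))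
    (α : EuclideanSpace ℝ X) {R : ℝ} (hR : 0 < R) (hsep : Real.pi / sepDist X ≤ R) :
    ballIntegral X α x₀ R ≤ cTwo ((halfBall d).indicator U) * R ^ d * ‖α‖ ^ 2 := by
  have hm := h.sInf_fourierUnitary_pos
  -- Dilation by 2R maps the ball of radius 1/2 to that of radius R and scales the points by 2R/(2π)
  -- = R/π, which are 1-separated once R ≥ π/q.
  have hR2 : R = 2 * R * (1 / 2) := by ring
  have hs : 2 * R / (2 * Real.pi) = R / Real.pi := by field_simp
  conv_lhs => rw [hR2, ballIntegral_eq X α x₀ (by positivity : 0 < 2 * R) (1 / 2), hs]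
  have key := h.setIntegral_exp_sum_le hN
    (one_le_dist_smul_of_div_sepDist_le Real.pi_pos hsep)
    (fun x : X => (α x : ℂ) * Complex.exp (Complex.I *
      ((inner ℝ x₀ (x : EuclideanSpace ℝ (Fin d)) : ℝ) : ℂ)))
    (mul_pos (by positivity : 0 < Real.sqrt (2 * Real.pi) ^ d) hm)
    (fun η hη => h.le_norm_fourier (mem_ball_zero_iff.1 hη).le)
  rw [sum_norm_sq_modulated] at key
  refine (mul_le_mul_of_nonneg_left key (by positivity)).trans (le_of_eq ?_)
  rw [h.cTwo_eq, mul_pow]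
  ring

/-- The argument yields the larger constant (√2 π/√λ)^d / 2; the comparison reduces to √(2π) ≤ 2π.
-/
theorem cOne_le (h : IsBallMode d lam U) (hlam : 0 < lam) :
    cOne d ≤ (2 * Real.pi / cZero d) ^ d * (1 / 2) := by
  rw [cOne, cZero, h.lambdaMin_eq, rpow_natCast_div_two Real.pi_pos.le,
    rpow_natCast_div_two hlam.le, mul_comm 2 (Real.sqrt lam ^ d), ← div_div, ← div_pow,
    div_eq_mul_one_div _ (2 : ℝ)]
  refine mul_le_mul_of_nonneg_right (pow_le_pow_left₀ (by positivity) ?_ d) (by norm_num)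
  rw [div_le_div_iff₀ (by positivity) (by positivity), ← mul_assoc]
  refine mul_le_mul_of_nonneg_right ?_ (by positivity)
  have h1 : Real.sqrt Real.pi * Real.sqrt 2 = Real.sqrt (Real.pi * 2) :=
    (Real.sqrt_mul Real.pi_pos.le 2).symm
  rw [h1]
  refine Real.sqrt_le_iff.2 ⟨by positivity, ?_⟩
  nlinarith [Real.pi_gt_three]

theorem le_ballIntegral (h : IsBallMode d lam U) (hlam : 0 < lam)
    (hN : ∫ x, (halfBall d).indicator U x ^ 2 = 1)
    (X : Finset (EuclideanSpace ℝ (Fin d))) (x₀ : EuclideanSpace ℝ (Fin d))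
    (α : EuclideanSpace ℝ X) {R : ℝ} (hR : 0 < R) (hsep : cZero d / sepDist X ≤ R) :
    cOne d * R ^ d * ‖α‖ ^ 2 ≤ ballIntegral X α x₀ R := by
  have hc : 0 < cZero d := by
    rw [cZero, h.lambdaMin_eq]
    positivity
  have hc2 : cZero d ^ 2 = 2 * lam := by
    rw [cZero, h.lambdaMin_eq, mul_pow, Real.sq_sqrt (by norm_num), Real.sq_sqrt hlam.le]
  -- The dilation that maps radius ρ = c₀/(2π), for which ρ² = λ/(2π²), to R; the points are scaled
  -- by R/c₀.
  set a := 2 * Real.pi * R / cZero d with ha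
  have hR2 : R = a * (cZero d / (2 * Real.pi)) := by rw [ha]; field_simp
  have hs : a / (2 * Real.pi) = R / cZero d := by rw [ha]; field_simp
  conv_rhs => rw [hR2, ballIntegral_eq X α x₀ (by positivity : 0 < a), hs]
  have key := h.le_setIntegral_exp_sum hN
    (one_le_dist_smul_of_div_sepDist_le hc hsep)
    (fun x : X => (α x : ℂ) * Complex.exp (Complex.I *
      ((inner ℝ x₀ (x : EuclideanSpace ℝ (Fin d)) : ℝ) : ℂ)))
    (ρ := cZero d / (2 * Real.pi)) (by positivity) (by rw [div_pow, hc2]; field_simp)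
  rw [sum_norm_sq_modulated] at key
  refine le_trans ?_ (mul_le_mul_of_nonneg_left key (by positivity))
  have h1 : a ^ d = (2 * Real.pi / cZero d) ^ d * R ^ d := by
    rw [← mul_pow, ha]; congr 1; ring
  rw [h1]
  have h2 := mul_le_mul_of_nonneg_right (h.cOne_le hlam)
    (by positivity : 0 ≤ R ^ d * ‖α‖ ^ 2)
  linarith

end IsBallMode

theorem ballIntegral_zero {d : ℕ} (X : Finset (EuclideanSpace ℝ (Fin d))) (α : EuclideanSpace ℝ X)
    (x₀ : EuclideanSpace ℝ (Fin d)) : ballIntegral X α x₀ 0 = 0 := by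
  simp [ballIntegral]

end

theorem mainTheorem2 (d : ℕ) (hd : 1 ≤ d) :
    ∃ H : EuclideanSpace ℝ (Fin d) → ℝ,
      IsGroundState d H ∧
      (∀ ω, (fourierUnitary H ω).im = 0) ∧
      0 < cOne d ∧ 0 < cTwo H ∧
      ∀ (X : Finset (EuclideanSpace ℝ (Fin d))) (x₀ : EuclideanSpace ℝ (Fin d))
        (α : EuclideanSpace ℝ X) (R : ℝ),
        (cZero d / sepDist X ≤ R →
          cOne d * R ^ d * ‖α‖ ^ 2 ≤ ballIntegral X α x₀ R ∧
          ballIntegral X α x₀ R ≤ cTwo H * R ^ d * ‖α‖ ^ 2) ∧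
        (Real.pi / sepDist X ≤ R →
          ballIntegral X α x₀ R ≤ cTwo H * R ^ d * ‖α‖ ^ 2) := by
  obtain ⟨lam, U, hlam, hpi, hU, hN⟩ := exists_normalized_ballMode hd
  have heven : ∀ x, (halfBall d).indicator U (-x) = (halfBall d).indicator U x := by
    intro x
    have hmem : -x ∈ halfBall d ↔ x ∈ halfBall d := by simp [halfBall]
    by_cases hx : x ∈ halfBall d
    · rw [Set.indicator_of_mem (hmem.2 hx), Set.indicator_of_mem hx, hU.even]
    · rw [Set.indicator_of_notMem (fun h => hx (hmem.1 h)), Set.indicator_of_notMem hx]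
  have hq : ∀ X : Finset (EuclideanSpace ℝ (Fin d)), 0 ≤ sepDist X := fun X => Set.infsep_nonneg
  -- Thus R ≥ c₀/q implies R ≥ π/q, and the upper bound is available on both ranges.
  have hc0 : Real.pi ≤ cZero d := by
    rw [cZero, hU.lambdaMin_eq, ← Real.sqrt_mul (by norm_num)]
    exact Real.le_sqrt_of_sq_le hpi
  have hcOne : 0 < cOne d := by
    rw [cOne, hU.lambdaMin_eq]
    positivity
  refine ⟨(halfBall d).indicator U, hU.isGroundState hN, fourierUnitary_im_eq_zero heven, hcOne,
    hU.cTwo_pos, fun X x₀ α R => ?_⟩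
  have upper : Real.pi / sepDist X ≤ R →
      ballIntegral X α x₀ R ≤ cTwo ((halfBall d).indicator U) * R ^ d * ‖α‖ ^ 2 := by
    intro hR
    -- If X has at most one point the hypothesis only says R ≥ 0. For R = 0 the ball is empty and
    -- 0^d = 0 since d ≥ 1.
    rcases ((div_nonneg Real.pi_pos.le (hq X)).trans hR).eq_or_lt with h0 | h0
    · rw [← h0, ballIntegral_zero, zero_pow (by omega)]
      simp
    · exact hU.ballIntegral_le hN X x₀ α h0 hR
  refine ⟨fun hR => ⟨?_, upper ((div_le_div_of_nonneg_right hc0 (hq X)).trans hR)⟩, upper⟩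
  rcases ((div_nonneg (Real.pi_pos.le.trans hc0) (hq X)).trans hR).eq_or_lt with h0 | h0
  · rw [← h0, ballIntegral_zero, zero_pow (by omega)]
    simp
  · exact hU.le_ballIntegral hlam hN X x₀ α h0 hR
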